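/- Let $A\in\mathbb R^{n\times n}$, $B\in\mathbb R^{n\times m}$ with $(A,B)$ controllable and $A$ neutrally stable, i.e. all eigenvalues of $A$ lie in the closed left half plane and those on the imaginary axis, if any, are semi-simple. Let $\sigma$ denote the componentwise saturation, $\sigma(v)_k=\operatorname{sgn}(v_k)\min(1,|v_k|)$. Consider $N$ agents $\dot x_i=Ax_i+B\sigma(u_i)$ with full-state coupling ($y_i=x_i$, i.e. $C=I$), and the exosystem $\dot x_r=Ax_r$. The communication graph is given by weights $a_{ij}\ge 0$, $a_{ii}=0$ (with an edge from $j$ to $i$ iff $a_{ij}>0$), and $\mathscr C\subseteq\{1,\dots,N\}$ is the root set of agents having access to the exosystem; $\iota_i=1$ if $i\in\mathscr C$ and $\iota_i=0$ otherwise. Agent $i$ receives $$\bar\zeta_i=\sum_{j=1}^N a_{ij}(x_i-x_j)+\iota_i(x_i-x_r),\qquad \hat\zeta_i=\sum_{j=1}^N a_{ij}(\xi_i-\xi_j),$$ where $\xi_i\in\mathbb R^n$ is a signal produced by the protocol of agent $i$. The scalable global regulated state synchronization problem is to find, from the knowledge of $(A,B)$ only, a linear dynamic protocol, with matrices common to all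 agents, $$\dot x_{c,i}=(A_c+\iota_iE_c)x_{c,i}+B_c\sigma(u_i)+C_c\bar\zeta_i+D_c\hat\zeta_i,\qquad u_i=F_cx_{c,i},\qquad \xi_i=H_cx_{c,i},$$ such that for every $N$, every $\mathscr C$, every graph in which each node is reachable by a directed path from some node of $\mathscr C$, and all initial conditions $x_i(0)$, $x_r(0)$, $x_{c,i}(0)$, the closed loop has a solution on $[0,\infty)$, and every such solution satisfies $x_i(t)-x_r(t)\to0$ for all $i$ (and hence $x_i(t)-x_j(t)\to 0$ for all $i,j$) as $t\to\infty$. Theorem. This problem is solvable. More precisely, there exists a symmetric $P>0$ with $PA+A^TP\le 0$, and for every such $P$ and every $\rho>0$ the protocol $$\dot\chi_i=A\chi_i+B\sigma(u_i)+\bar\zeta_i-\hat\zeta_i-\iota_i\chi_i,\qquad u_i=-\rho B^TP\chi_i,\qquad \xi_i=\chi_i,$$ solves it. -/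

import Mathlib

open Matrix

namespace SatSync

/-! ### Linear systems -/

/-- The controllability matrix `[B, AB, …, Aⁿ⁻¹B]`, with columns indexed by (power, input). -/
def controllabilityMatrix {n m : ℕ} (A : Matrix (Fin n) (Fin n) ℝ) (B : Matrix (Fin n) (Fin m) ℝ) :
    Matrix (Fin n) (Fin n × Fin m) ℝ :=
  Matrix.of fun i p => (A ^ (p.1 : ℕ) * B) i p.2

/-- The pair `(A, B)` is controllable (Kalman rank condition). -/
def IsControllable {n m : ℕ} (A : Matrix (Fin n) (Fin n) ℝ) (B : Matrix (Fin n) (Fin m) ℝ) : Prop :=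
  (controllabilityMatrix A B).rank = n

/-- The observability matrix `[C; CA; …; CAⁿ⁻¹]`, with rows indexed by (power, output). -/
def observabilityMatrix {n q : ℕ} (A : Matrix (Fin n) (Fin n) ℝ) (C : Matrix (Fin q) (Fin n) ℝ) :
    Matrix (Fin n × Fin q) (Fin n) ℝ :=
  Matrix.of fun p j => (C * A ^ (p.1 : ℕ)) p.2 j

/-- The pair `(A, C)` is observable (Kalman rank condition). -/
def IsObservable {n q : ℕ} (A : Matrix (Fin n) (Fin n) ℝ) (C : Matrix (Fin q) (Fin n) ℝ) : Prop :=
  (observabilityMatrix A C).rank = n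

/-- `A` is neutrally stable: all (complex) eigenvalues lie in the closed left half plane, and those
on the imaginary axis are semi-simple, i.e. their generalized eigenvectors are eigenvectors. -/
def IsNeutrallyStable {n : ℕ} (A : Matrix (Fin n) (Fin n) ℝ) : Prop :=
  ∀ z : ℂ, Module.End.HasEigenvalue (Matrix.toLin' (A.map Complex.ofReal)) z →
    z.re ≤ 0 ∧
    (z.re = 0 → Module.End.maxGenEigenspace (Matrix.toLin' (A.map Complex.ofReal)) z =
      Module.End.eigenspace (Matrix.toLin' (A.map Complex.ofReal)) z)

/-- The assumption on the agent model `(A, B, C)`. -/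
structure NeutrallyStableAgent {n m q : ℕ} (A : Matrix (Fin n) (Fin n) ℝ)
    (B : Matrix (Fin n) (Fin m) ℝ) (C : Matrix (Fin q) (Fin n) ℝ) : Prop where
  controllable : IsControllable A B
  observable : IsObservable A C
  neutrallyStable : IsNeutrallyStable A

/-! ### Saturation -/

/-- The standard saturation function `sat(w) = sgn(w) min(1, |w|)`. -/
noncomputable def sat (w : ℝ) : ℝ := Real.sign w * min 1 |w|

/-- Componentwise saturation `σ` of a vector. -/
noncomputable def satVec {m : ℕ} (v : Fin m → ℝ) : Fin m → ℝ := fun k => sat (v k)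

/-! ### Communication graphs -/

/-- A weighted directed graph on the nodes `Fin N` without self-loops, given by its weighted
adjacency matrix; there is an edge from `j` to `i` iff `0 < a i j`. -/
structure WeightedGraph (N : ℕ) where
  a : Matrix (Fin N) (Fin N) ℝ
  nonneg : ∀ i j, 0 ≤ a i j
  no_loop : ∀ i, a i i = 0

/-- There is an edge from `j` to `i`. -/
def WeightedGraph.Edge {N : ℕ} (G : WeightedGraph N) (j i : Fin N) : Prop := 0 < G.a i j

/-- Every node of `G` can be reached along a directed path (possibly of length zero) starting at
a node of the root set `S`. -/
def WeightedGraph.IsRootedIn {N : ℕ} (G : WeightedGraph N) (S : Set (Fin N)) : Prop :=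
  ∀ i, ∃ r ∈ S, Relation.ReflTransGen G.Edge r i

/-- `ι_i = 1` if `i ∈ S` and `ι_i = 0` otherwise. -/
noncomputable def rootIndicator {N : ℕ} (S : Set (Fin N)) (i : Fin N) : ℝ :=
  S.indicator (fun _ => (1 : ℝ)) i

/-- The diffusive quantity `∑_j a_ij (v_i - v_j)`. -/
def WeightedGraph.exchange {N k : ℕ} (G : WeightedGraph N) (v : Fin N → Fin k → ℝ) (i : Fin N) :
    Fin k → ℝ :=
  ∑ j, G.a i j • (v i - v j)

/-- The network measurement `∑_j a_ij (y_i - y_j) + ι_i (y_i - y_r)`. -/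
noncomputable def WeightedGraph.regulatedExchange {N k : ℕ} (G : WeightedGraph N) (S : Set (Fin N))
    (y : Fin N → Fin k → ℝ) (yr : Fin k → ℝ) (i : Fin N) : Fin k → ℝ :=
  G.exchange y i + rootIndicator S i • (y i - yr)

/-! ### Protocols and closed loops -/

/-- A linear dynamic protocol, with state `x_c` in `ℝ^nc`,
`x_c' = Ac x_c + ι Ec x_c + Bc σ(u) + Cc ζbar + Dc ζhat`, `u = Fc x_c`, `ξ = Hc x_c`.
The matrices are common to all agents; an agent only knows, besides its signals, whether it is
connected to the exosystem (`ι = 1`) or not (`ι = 0`). -/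
structure LinearProtocol (n m q : ℕ) where
  nc : ℕ
  Ac : Matrix (Fin nc) (Fin nc) ℝ
  Ec : Matrix (Fin nc) (Fin nc) ℝ
  Bc : Matrix (Fin nc) (Fin m) ℝ
  Cc : Matrix (Fin nc) (Fin q) ℝ
  Dc : Matrix (Fin nc) (Fin n) ℝ
  Fc : Matrix (Fin m) (Fin nc) ℝ
  Hc : Matrix (Fin n) (Fin nc) ℝ

/-- `xr`, `x`, `xc` are trajectories on `[0, ∞)` of the exosystem, of the `N` agents and of their
protocols, interconnected over the network. -/
structure IsClosedLoopSolution {n m q N : ℕ} (A : Matrix (Fin n) (Fin n) ℝ)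
    (B : Matrix (Fin n) (Fin m) ℝ) (C : Matrix (Fin q) (Fin n) ℝ) (K : LinearProtocol n m q)
    (G : WeightedGraph N) (S : Set (Fin N))
    (xr : ℝ → Fin n → ℝ) (x : ℝ → Fin N → Fin n → ℝ) (xc : ℝ → Fin N → Fin K.nc → ℝ) : Prop where
  exosystem : ∀ t, 0 ≤ t → HasDerivWithinAt xr (A *ᵥ xr t) (Set.Ici 0) t
  agents : ∀ i t, 0 ≤ t → HasDerivWithinAt (fun s => x s i)
    (A *ᵥ x t i + B *ᵥ satVec (K.Fc *ᵥ xc t i)) (Set.Ici 0) t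
  protocols : ∀ i t, 0 ≤ t → HasDerivWithinAt (fun s => xc s i)
    (K.Ac *ᵥ xc t i + rootIndicator S i • (K.Ec *ᵥ xc t i)
      + K.Bc *ᵥ satVec (K.Fc *ᵥ xc t i)
      + K.Cc *ᵥ G.regulatedExchange S (fun j => C *ᵥ x t j) (C *ᵥ xr t) i
      + K.Dc *ᵥ G.exchange (fun j => K.Hc *ᵥ xc t j) i) (Set.Ici 0) t

/-- Regulated state synchronization: all agent states converge to the trajectory of the exosystem,
and hence to each other. -/
def RegulatedSync {n N : ℕ} (xr : ℝ → Fin n → ℝ) (x : ℝ → Fin N → Fin n → ℝ) : Prop :=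
  (∀ i, Filter.Tendsto (fun t => x t i - xr t) Filter.atTop (nhds 0)) ∧
  (∀ i j, Filter.Tendsto (fun t => x t i - x t j) Filter.atTop (nhds 0))

/-- The protocol `K` achieves regulated state synchronization for any number of agents, any root
set, any graph all of whose nodes are reachable from the root set, and all initial conditions of
exosystem, agents and protocols: a closed-loop trajectory on `[0, ∞)` exists, and every one
synchronizes. -/
def SolvesScalableSync {n m q : ℕ} (A : Matrix (Fin n) (Fin n) ℝ) (B : Matrix (Fin n) (Fin m) ℝ)
    (C : Matrix (Fin q) (Fin n) ℝ) (K : LinearProtocol n m q) : Prop :=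
  ∀ (N : ℕ) (S : Set (Fin N)) (G : WeightedGraph N), G.IsRootedIn S →
    ∀ (xr0 : Fin n → ℝ) (x0 : Fin N → Fin n → ℝ) (xc0 : Fin N → Fin K.nc → ℝ),
      (∃ xr x xc, IsClosedLoopSolution A B C K G S xr x xc ∧ xr 0 = xr0 ∧ x 0 = x0 ∧ xc 0 = xc0) ∧
      (∀ xr x xc, IsClosedLoopSolution A B C K G S xr x xc → xr 0 = xr0 → x 0 = x0 → xc 0 = xc0 →
        RegulatedSync xr x)

/-- The scalable global regulated state synchronization problem for the agent model `(A, B, C)`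
is solvable: some protocol, chosen from the agent model alone, solves it. -/
def ScalableSyncSolvable {n m q : ℕ} (A : Matrix (Fin n) (Fin n) ℝ) (B : Matrix (Fin n) (Fin m) ℝ)
    (C : Matrix (Fin q) (Fin n) ℝ) : Prop :=
  ∃ K : LinearProtocol n m q, SolvesScalableSync A B C K

/-- `P > 0` (symmetric) and `P A + Aᵀ P ≤ 0`. -/
def IsLyapunovMatrix {n : ℕ} (A P : Matrix (Fin n) (Fin n) ℝ) : Prop :=
  P.PosDef ∧ (-(P * A + Aᵀ * P)).PosSemidef

/-- The full-state coupling protocol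
`χ' = A χ + B σ(u) + ζbar - ζhat - ι χ`, `u = -ρ Bᵀ P χ`, `ξ = χ`. -/
def fullStateProtocol {n m : ℕ} (A : Matrix (Fin n) (Fin n) ℝ) (B : Matrix (Fin n) (Fin m) ℝ)
    (P : Matrix (Fin n) (Fin n) ℝ) (ρ : ℝ) : LinearProtocol n m n where
  nc := n
  Ac := A
  Ec := -1
  Bc := B
  Cc := 1
  Dc := -1
  Fc := -(ρ • (Bᵀ * P))
  Hc := 1

end SatSync

/-! Put `z i = x i - xr` and `e i = z i - χ i`. The protocol copies the input term `B σ(u)`, and its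
coupling terms add up to the exchange and root terms of `e`; hence `e` obeys an autonomous linear
equation `e' = A e - L e`, with `L` a grounded Laplacian, while `z' = A z - B σ(ρ Bᵀ P (z - e))`.
Saturation enters only the second equation.

Both are controlled by one energy `W = ∑ (zᵢᵀ P zᵢ + c γᵢ eᵢᵀ P eᵢ)`. Rootedness makes the grounded
Laplacian inverse-positive (a minimum principle), which supplies weights `γ > 0` with `γᵀ L = 𝟙ᵀ`
(`exists_weight`), so the `e`-part decays at rate at least `c ∑ eᵢᵀ P eᵢ`. The sector bound on `σ`
and Young's inequality bound the effect of `e` on `z` by a multiple of the same sum, and `c` is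
chosen to absorb it. The graph enters only through `γ`, which the protocol never sees; this is the
source of scalability.

As `W` decreases, trajectories are bounded and Barbalat's lemma sends the dissipation to zero: `e →
0`, `Bᵀ P z → 0`, `σ → 0` and `(P A + Aᵀ P) z → 0`. Thus `z` solves `z' = A z + r` with `r → 0`;
repeated use of Barbalat gives `Bᵀ P Aʲ z → 0`, the vanishing of `(P A + Aᵀ P) Aʲ z` lets `A` be
moved across `P`, and controllability yields `P z → 0`.

Two existence facts complete the proof. Closed-loop trajectories are global because the vector field
is globally Lipschitz. A Lyapunov matrix `P` comes from summing weighted norms along the Jordan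
chains of the complexified `A`; semi-simplicity makes the chains on the imaginary axis have length
one. -/

section

open Filter Set Topology

/-! ### Global solutions of globally Lipschitz equations -/

section ODE

variable {E : Type*} [NormedAddCommGroup E] [NormedSpace ℝ E]

/-- Solutions of an autonomous ODE on adjacent intervals can be glued. -/
theorem exists_solution_Icc_glue {f : E → E} {a b c : ℝ} (hab : a ≤ b) (hbc : b ≤ c) {α β : ℝ → E}
    (hα : ∀ t ∈ Icc a b, HasDerivWithinAt α (f (α t)) (Icc a b) t)
    (hβ : ∀ t ∈ Icc b c, HasDerivWithinAt β (f (β t)) (Icc b c) t) (h : α b = β b) :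
    ∃ γ : ℝ → E, γ a = α a ∧ ∀ t ∈ Icc a c, HasDerivWithinAt γ (f (γ t)) (Icc a c) t := by
  classical
  set γ : ℝ → E := fun t => if t ≤ b then α t else β t with hγ
  have h1 : ∀ t ∈ Icc a b, γ t = α t := fun t ht => by simp [hγ, ht.2]
  have h2 : ∀ t ∈ Icc b c, γ t = β t := fun t ht => by
    rcases ht.1.eq_or_lt with rfl | hlt
    · simp [hγ, h]
    · simp [hγ, not_le.2 hlt]
  refine ⟨γ, h1 a ⟨le_rfl, hab⟩, fun t ht => ?_⟩
  -- Differentiability within the union is checked on each piece; away from a closed piece the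
  -- condition is vacuous, so only `t = b` sees both.
  rw [← Icc_union_Icc_eq_Icc hab hbc]
  refine HasDerivWithinAt.union ?_ ?_
  · by_cases hm : t ∈ Icc a b
    · rw [h1 t hm]
      exact (hα t hm).congr h1 (h1 t hm)
    · exact HasFDerivWithinAt.of_notMem_closure (by rwa [closure_Icc])
  · by_cases hm : t ∈ Icc b c
    · rw [h2 t hm]
      exact (hβ t hm).congr h2 (h2 t hm)
    · exact HasFDerivWithinAt.of_notMem_closure (by rwa [closure_Icc])

/-- A globally Lipschitz vector field has solutions on intervals of a length that does not depend
on the initial value. -/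
theorem LipschitzWith.exists_solution_Icc_step [CompleteSpace E] {f : E → E} {K : NNReal}
    (hf : LipschitzWith K f) (t₀ : ℝ) (x₀ : E) :
    ∃ α : ℝ → E, α t₀ = x₀ ∧ ∀ t ∈ Icc t₀ (t₀ + (2 * (K + 1 : ℝ))⁻¹),
      HasDerivWithinAt α (f (α t)) (Icc t₀ (t₀ + (2 * (K + 1 : ℝ))⁻¹)) t := by
  have hK : (0 : ℝ) < K + 1 := by positivity
  -- On the ball of radius `‖f x₀‖ / (K + 1)` the field is bounded by `2 ‖f x₀‖`; the ratio of
  -- radius to bound is `1 / (2 (K + 1))`, free of `x₀`.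
  have hpl : IsPicardLindelof (fun _ => f) (tmin := t₀) (tmax := t₀ + (2 * (K + 1 : ℝ))⁻¹)
      ⟨t₀, le_rfl, by simp; positivity⟩ x₀ (‖f x₀‖₊ / (K + 1)) 0 (2 * ‖f x₀‖₊) K := by
    refine ⟨fun t _ => hf.lipschitzOnWith, fun x _ => continuousOn_const, fun t _ x hx => ?_, ?_⟩
    · have h1 := hf.dist_le_mul x x₀
      rw [Metric.mem_closedBall] at hx
      push_cast at hx
      have h2 : (K : ℝ) * dist x x₀ ≤ ‖f x₀‖ := by
        calc (K : ℝ) * dist x x₀ ≤ (K + 1) * (‖f x₀‖ / (K + 1)) := by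
              gcongr
              linarith
          _ = ‖f x₀‖ := by field_simp
      have h3 : ‖f x‖ ≤ ‖f x - f x₀‖ + ‖f x₀‖ := by simpa using norm_add_le (f x - f x₀) (f x₀)
      rw [← dist_eq_norm] at h3
      push_cast
      linarith
    · have h0 : (0 : ℝ) ≤ (2 * (K + 1 : ℝ))⁻¹ := by positivity
      push_cast
      simp only [add_sub_cancel_left, sub_self, sub_zero]
      rw [max_eq_left h0]
      apply le_of_eq
      field_simp
  exact hpl.exists_eq_forall_mem_Icc_hasDerivWithinAt₀

theorem LipschitzWith.exists_solution_Icc [CompleteSpace E] {f : E → E} {K : NNReal}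
    (hf : LipschitzWith K f) (x₀ : E) (T : ℝ) :
    ∃ α : ℝ → E, α 0 = x₀ ∧ ∀ t ∈ Icc 0 T, HasDerivWithinAt α (f (α t)) (Icc 0 T) t := by
  set h : ℝ := (2 * (K + 1 : ℝ))⁻¹ with hh
  have hpos : 0 < h := by positivity
  have key : ∀ n : ℕ, ∃ α : ℝ → E, α 0 = x₀ ∧
      ∀ t ∈ Icc 0 ((n + 1) * h), HasDerivWithinAt α (f (α t)) (Icc 0 ((n + 1) * h)) t := by
    intro n
    induction n with
    | zero =>
      have := hf.exists_solution_Icc_step 0 x₀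
      rw [← hh, zero_add] at this
      simpa using this
    | succ n ih =>
      obtain ⟨α, hα0, hα⟩ := ih
      obtain ⟨β, hβ0, hβ⟩ := hf.exists_solution_Icc_step ((n + 1) * h) (α ((n + 1) * h))
      obtain ⟨γ, hγ0, hγ⟩ :=
        exists_solution_Icc_glue (by positivity) (by linarith) hα hβ hβ0.symm
      refine ⟨γ, hγ0.trans hα0, ?_⟩
      have : ((n + 1 : ℕ) + 1 : ℝ) * h = (n + 1) * h + h := by push_cast; ring
      rw [this]
      exact hγ
  obtain ⟨n, hn⟩ := exists_nat_ge (T / h)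
  obtain ⟨α, hα0, hα⟩ := key n
  have hT : T ≤ (n + 1) * h := by
    rw [div_le_iff₀ hpos] at hn
    linarith
  have hsub : Icc 0 T ⊆ Icc 0 ((n + 1) * h) := Icc_subset_Icc_right hT
  exact ⟨α, hα0, fun t ht => (hα t (hsub ht)).mono hsub⟩

/-- Global existence of solutions, forward in time, for a globally Lipschitz vector field. -/
theorem LipschitzWith.exists_solution_Ici [CompleteSpace E] {f : E → E} {K : NNReal}
    (hf : LipschitzWith K f) (x₀ : E) :
    ∃ α : ℝ → E, α 0 = x₀ ∧ ∀ t, 0 ≤ t → HasDerivWithinAt α (f (α t)) (Ici 0) t := by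
  choose α hα0 hα using fun n : ℕ => hf.exists_solution_Icc x₀ n
  have huniq : ∀ n m : ℕ, ∀ t ∈ Icc (0 : ℝ) n, t ≤ m → α n t = α m t := by
    intro n m t ht htm
    have hcont : ∀ k : ℕ, t ≤ k → ContinuousOn (α k) (Icc 0 t) := fun k hk s hs =>
      (hα k s ⟨hs.1, hs.2.trans hk⟩).continuousWithinAt.mono (Icc_subset_Icc_right hk)
    have hder : ∀ k : ℕ, t ≤ k → ∀ s ∈ Ico 0 t, HasDerivWithinAt (α k) (f (α k s)) (Ici s) s := by
      intro k hk s hs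
      refine (hα k s ⟨hs.1, hs.2.le.trans hk⟩).mono_of_mem_nhdsWithin ?_
      refine mem_of_superset (Icc_mem_nhdsGE (hs.2.trans_le hk)) (Icc_subset_Icc_left hs.1)
    exact ODE_solution_unique (v := fun _ => f) (fun _ => hf) (hcont n ht.2) (hder n ht.2)
      (hcont m htm) (hder m htm) ((hα0 n).trans (hα0 m).symm) ⟨ht.1, le_rfl⟩
  -- By uniqueness the solutions on `[0, k]` agree where they overlap, so near `t` this function
  -- equals one fixed `α n` with `n > t`.
  refine ⟨fun t => α ⌈t⌉₊ t, by simp [hα0], fun t ht => ?_⟩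
  obtain ⟨n, hn⟩ := exists_nat_gt t
  have heq : ∀ s ∈ Ico (0 : ℝ) n, α ⌈s⌉₊ s = α n s := fun s hs =>
    huniq _ _ s ⟨hs.1, Nat.le_ceil s⟩ hs.2.le
  have hmem : Ico (0 : ℝ) n ∈ 𝓝[Ici 0] t := by
    rw [← Ici_inter_Iio]
    exact inter_mem self_mem_nhdsWithin (mem_nhdsWithin_of_mem_nhds (Iio_mem_nhds hn))
  beta_reduce
  rw [heq t ⟨ht, hn⟩]
  refine HasDerivWithinAt.congr_of_eventuallyEq ?_ (mem_of_superset hmem heq) (heq t ⟨ht, hn⟩)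
  exact (hα n t ⟨ht, hn.le⟩).mono_of_mem_nhdsWithin (mem_of_superset hmem Ico_subset_Icc_self)

end ODE

/-! ### Barbalat-type lemmas -/

section Barbalat

/-- One-sided Barbalat lemma. -/
theorem eventually_le_of_hasDerivWithinAt_le {g g' p r : ℝ → ℝ} {l : ℝ}
    (hg : ∀ t, 0 ≤ t → HasDerivWithinAt g (g' t) (Ici 0) t)
    (hle : ∀ t, 0 ≤ t → g' t ≤ -p t + r t) (hl : Tendsto g atTop (𝓝 l))
    (hr : Tendsto r atTop (𝓝 0)) (hp : UniformContinuousOn p (Ici 0)) {ε : ℝ} (hε : 0 < ε) :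
    ∀ᶠ t in atTop, p t ≤ ε := by
  rw [Metric.uniformContinuousOn_iff] at hp
  obtain ⟨δ, hδ, hp⟩ := hp (ε / 4) (by positivity)
  have hrε := Metric.tendsto_atTop.1 hr (ε / 4) (by positivity)
  have hgε := Metric.tendsto_atTop.1 hl (ε * δ / 16) (by positivity)
  obtain ⟨R, hR⟩ := hrε
  obtain ⟨S, hS⟩ := hgε
  filter_upwards [eventually_ge_atTop (max 0 (max R S))] with t ht
  simp only [max_le_iff] at ht
  obtain ⟨ht0, htR, htS⟩ := ht
  -- If `p t > ε`, then on `[t, t + δ/2]` one has `p > 3ε/4` and `r < ε/4`, so `g` falls by at least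
  -- `εδ/4`; both end values lie within `εδ/16` of `l`.
  by_contra! hpt
  have hlt : t < t + δ / 2 := by linarith
  obtain ⟨c, hc, hslope⟩ := exists_hasDerivAt_eq_slope g g' hlt
    (fun s hs => (hg s (ht0.trans hs.1)).continuousWithinAt.mono
      (fun u hu => ht0.trans hu.1))
    (fun s hs => (hg s (ht0.trans hs.1.le)).hasDerivAt (Ici_mem_nhds (ht0.trans_lt hs.1)))
  have hc0 : 0 ≤ c := ht0.trans hc.1.le
  have h1 := hp c hc0 t ht0 (by rw [Real.dist_eq, abs_lt]; constructor <;> linarith [hc.1, hc.2])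
  have h2 := hR c (htR.trans hc.1.le)
  have h3 := hS t htS
  have h4 := hS (t + δ / 2) (htS.trans hlt.le)
  rw [Real.dist_eq, abs_lt] at h1 h2 h3 h4
  have h5 := hle c hc0
  rw [hslope, add_sub_cancel_left, div_le_iff₀ (by positivity)] at h5
  nlinarith

/-- Barbalat's lemma with a vanishing perturbation. -/
theorem tendsto_zero_of_hasDerivWithinAt_add {g p r : ℝ → ℝ} {l : ℝ}
    (hg : ∀ t, 0 ≤ t → HasDerivWithinAt g (p t + r t) (Ici 0) t) (hl : Tendsto g atTop (𝓝 l))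
    (hr : Tendsto r atTop (𝓝 0)) (hp : UniformContinuousOn p (Ici 0)) :
    Tendsto p atTop (𝓝 0) := by
  rw [Metric.tendsto_nhds]
  intro ε hε
  have hp' : UniformContinuousOn (fun t => -p t) (Ici 0) := uniformContinuous_neg.comp_uniformContinuousOn hp
  have h1 := eventually_le_of_hasDerivWithinAt_le hg (p := fun t => -p t) (r := r)
    (fun t _ => by simp) hl hr hp' (half_pos hε)
  have h2 := eventually_le_of_hasDerivWithinAt_le (fun t ht => (hg t ht).neg) (p := p)
    (r := fun t => -r t) (fun t _ => by simp) hl.neg (by simpa using hr.neg) hp (half_pos hε)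
  filter_upwards [h1, h2] with t ht1 ht2
  rw [Real.dist_eq, abs_lt]
  constructor <;> linarith

/-- A nonnegative function on `[0, ∞)` whose derivative is bounded by `-p` with `p ≥ 0` uniformly
continuous forces `p → 0`. -/
theorem tendsto_zero_of_hasDerivWithinAt_le_neg {g g' p : ℝ → ℝ}
    (hg : ∀ t, 0 ≤ t → HasDerivWithinAt g (g' t) (Ici 0) t) (hle : ∀ t, 0 ≤ t → g' t ≤ -p t)
    (hg0 : ∀ t, 0 ≤ t → 0 ≤ g t) (hp0 : ∀ t, 0 ≤ t → 0 ≤ p t)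
    (hp : UniformContinuousOn p (Ici 0)) : Tendsto p atTop (𝓝 0) := by
  have hanti : AntitoneOn g (Ici 0) := by
    refine antitoneOn_of_hasDerivWithinAt_nonpos (f' := g') (convex_Ici 0)
      (fun t ht => (hg t ht).continuousWithinAt) (fun t ht => ?_) (fun t ht => ?_)
    · exact (hg t (interior_subset ht)).mono interior_subset
    · have := hp0 t (interior_subset ht)
      linarith [hle t (interior_subset ht)]
  obtain ⟨l, hl⟩ : ∃ l, Tendsto g atTop (𝓝 l) := by
    -- Freezing `g` on negative times makes it antitone on the whole line, where monotone
    -- convergence applies.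
    have h1 : Antitone fun t => g (max t 0) := fun s t hst =>
      hanti (mem_Ici.2 (le_max_right _ _)) (mem_Ici.2 (le_max_right _ _)) (max_le_max_right _ hst)
    refine ⟨_, (tendsto_atTop_ciInf h1 ⟨0, ?_⟩).congr' ?_⟩
    · rintro _ ⟨t, rfl⟩
      exact hg0 _ (le_max_right _ _)
    · filter_upwards [eventually_ge_atTop 0] with t ht
      simp [ht]
  rw [Metric.tendsto_nhds]
  intro ε hε
  have h1 := eventually_le_of_hasDerivWithinAt_le hg (r := fun _ => 0)
    (fun t ht => by simpa using hle t ht) hl tendsto_const_nhds hp (half_pos hε)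
  filter_upwards [h1, eventually_ge_atTop 0] with t ht ht0
  rw [Real.dist_eq, abs_lt]
  constructor <;> linarith [hp0 t ht0]

end Barbalat

end

/-! ### Spectral decomposition by polynomials -/

section Decomposition

open Polynomial

/-- A polynomial form of the generalized eigenspace decomposition. -/
theorem Module.End.exists_polynomial_family {K V : Type*} [Field K] [IsAlgClosed K]
    [AddCommGroup V] [Module K V] [Module.Finite K V] (f : Module.End K V) :
    ∃ (R : Finset K) (p : K → K[X]) (N : ℕ), (∀ z ∈ R, f.HasEigenvalue z) ∧
      (∀ z ∈ R, ∀ x, ((f - algebraMap K _ z) ^ N) (aeval f (p z) x) = 0) ∧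
      (∀ x, (∀ z ∈ R, aeval f (p z) x = 0) → x = 0) := by
  classical
  set χ := f.charpoly with hχ
  have hmonic : χ.Monic := f.charpoly_monic
  set N := Multiset.card χ.roots with hN
  set R := χ.roots.toFinset with hR
  -- The exponent `N`, the number of roots with multiplicity, dominates every single multiplicity,
  -- so `(X - z)^N p_z` is a multiple of the characteristic polynomial and Cayley–Hamilton applies.
  refine ⟨R, fun z => ∏ w ∈ R \ {z}, (X - C w) ^ N, N, fun z hz => ?_, fun z hz x => ?_,
    fun x hx => ?_⟩
  · rw [Module.End.hasEigenvalue_iff_isRoot_charpoly]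
    exact Polynomial.isRoot_of_mem_roots (Multiset.mem_toFinset.1 hz)
  · have hdvd : χ ∣ (X - C z) ^ N * ∏ w ∈ R \ {z}, (X - C w) ^ N := by
      have h1 : (X - C z) ^ N * ∏ w ∈ R \ {z}, (X - C w) ^ N = ∏ w ∈ R, (X - C w) ^ N := by
        rw [Finset.prod_eq_mul_prod_sdiff_singleton_of_mem hz]
      rw [h1]
      conv_lhs => rw [(IsAlgClosed.splits χ).eq_prod_roots_of_monic hmonic,
        Finset.prod_multiset_map_count]
      exact Finset.prod_dvd_prod_of_dvd _ _ fun w _ => pow_dvd_pow _ (Multiset.count_le_card _ _)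
    have h0 : aeval f ((X - C z) ^ N * ∏ w ∈ R \ {z}, (X - C w) ^ N) = 0 := by
      obtain ⟨q, hq⟩ := hdvd
      rw [hq, map_mul, hχ, f.aeval_self_charpoly, zero_mul]
    have h2 := congrArg (fun g : Module.End K V => g x) h0
    simpa [map_mul, map_pow] using h2
  · by_contra hx0
    have : Nontrivial V := nontrivial_of_ne x 0 hx0
    have hne : R.Nonempty := by
      obtain ⟨z, hz⟩ := Module.End.exists_eigenvalue f
      rw [Module.End.hasEigenvalue_iff_isRoot_charpoly] at hz
      exact ⟨z, Multiset.mem_toFinset.2 ((mem_roots hmonic.ne_zero).2 hz)⟩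
    -- Bézout: `1 = ∑ w_z p_z`, so `x` is recovered from the vectors `p_z(f) x`.
    obtain ⟨w, hw⟩ := (exists_sum_eq_one_iff_pairwise_coprime (s := fun z : K => (X - C z) ^ N)
      hne).2 (fun a b hab => (isCoprime_X_sub_C_of_isUnit_sub
        (sub_ne_zero_of_ne (fun h => hab (Subtype.ext h))).isUnit).pow)
    apply hx0
    have h3 := congrArg (fun q => aeval f q x) hw
    simp only [map_sum, map_mul, map_one, LinearMap.sum_apply, Module.End.mul_apply,
      Module.End.one_apply] at h3
    rw [← h3]
    refine Finset.sum_eq_zero fun z hz => ?_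
    have h4 : aeval f (∏ w ∈ R \ {z}, (X - C w) ^ N) x = 0 := hx z hz
    rw [h4, map_zero]

end Decomposition

/-! ### A Lyapunov matrix for a neutrally stable `A` -/

section LyapunovExistence

variable {n : ℕ}

/-- The real part of the standard Hermitian inner product on `ℂⁿ`. -/
noncomputable def reDot (y z : Fin n → ℂ) : ℝ := (star y ⬝ᵥ z).re

theorem reDot_add_left (x y z : Fin n → ℂ) : reDot (x + y) z = reDot x z + reDot y z := by
  simp [reDot, add_dotProduct]

theorem reDot_add_right (x y z : Fin n → ℂ) : reDot x (y + z) = reDot x y + reDot x z := by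
  simp [reDot, dotProduct_add]

theorem reDot_smul_left (c : ℝ) (y z : Fin n → ℂ) : reDot (c • y) z = c * reDot y z := by
  simp [reDot, star_smul, smul_dotProduct]

theorem reDot_smul_right (c : ℝ) (y z : Fin n → ℂ) : reDot y (c • z) = c * reDot y z := by
  simp [reDot, dotProduct_smul]

theorem reDot_eq_sum (y z : Fin n → ℂ) :
    reDot y z = ∑ i, ((y i).re * (z i).re + (y i).im * (z i).im) := by
  simp [reDot, dotProduct, Complex.re_sum]

theorem reDot_comm (y z : Fin n → ℂ) : reDot y z = reDot z y := by
  simp only [reDot_eq_sum, mul_comm]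

theorem reDot_self_nonneg (y : Fin n → ℂ) : 0 ≤ reDot y y := by
  rw [reDot_eq_sum]
  exact Finset.sum_nonneg fun i _ => add_nonneg (mul_self_nonneg _) (mul_self_nonneg _)

theorem reDot_self_pos {y : Fin n → ℂ} (hy : y ≠ 0) : 0 < reDot y y := by
  obtain ⟨i, hi⟩ := Function.ne_iff.1 hy
  rw [reDot_eq_sum]
  refine Finset.sum_pos' (fun i _ => add_nonneg (mul_self_nonneg _) (mul_self_nonneg _))
    ⟨i, Finset.mem_univ i, ?_⟩
  simpa [Complex.normSq_apply] using Complex.normSq_pos.2 hi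

theorem reDot_complex_smul_self (c : ℂ) (y : Fin n → ℂ) :
    reDot y (c • y) = c.re * reDot y y := by
  simp only [reDot_eq_sum, Finset.mul_sum, Pi.smul_apply, smul_eq_mul, Complex.mul_re,
    Complex.mul_im]
  exact Finset.sum_congr rfl fun i _ => by ring

theorem two_mul_reDot_le {μ : ℝ} (hμ : 0 < μ) (y z : Fin n → ℂ) :
    2 * reDot y z ≤ μ * reDot y y + μ⁻¹ * reDot z z := by
  have h := reDot_self_nonneg (μ • y + (-1 : ℝ) • z)
  simp only [reDot_add_left, reDot_add_right, reDot_smul_left, reDot_smul_right,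
    reDot_comm z y] at h
  have h2 : 0 ≤ μ⁻¹ * (μ * (μ * reDot y y) - 2 * μ * reDot y z + reDot z z) :=
    mul_nonneg (by positivity) (by linarith)
  have h3 : μ⁻¹ * (μ * (μ * reDot y y) - 2 * μ * reDot y z + reDot z z) =
    μ * reDot y y - 2 * reDot y z + μ⁻¹ * reDot z z := by field_simp
  linarith

/-- The weighted form along a Jordan chain of an operator with eigenvalue `z` is nonincreasing. -/
theorem sum_reDot_chain_nonpos {z : ℂ} (hz : z.re ≤ 0) (y : ℕ → Fin n → ℂ) {N : ℕ}
    (hN : y N = 0) (h0 : z.re = 0 → ∀ k, y (k + 1) = 0) :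
    ∑ k ∈ Finset.range N, ((z.re⁻¹) ^ 2) ^ k * reDot (y k) (y (k + 1) + z • y k) ≤ 0 := by
  rcases hz.eq_or_lt with h | h
  · refine Finset.sum_nonpos fun k _ => ?_
    rw [h0 h k, zero_add, reDot_complex_smul_self, h]
    simp
  · set μ := -z.re with hμ
    have hμ0 : 0 < μ := by linarith
    have hre : z.re = -μ := by simp [hμ]
    -- Young's inequality leaves `(2μ)⁻¹ |y_{k+1}|² - (μ/2) |y_k|²`; the weights `μ^(-2k)` are
    -- exactly those that make this telescope.
    set F : ℕ → ℝ := fun k => μ / 2 * (((μ⁻¹) ^ 2) ^ k * reDot (y k) (y k)) with hF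
    have hterm : ∀ k ∈ Finset.range N,
        ((z.re⁻¹) ^ 2) ^ k * reDot (y k) (y (k + 1) + z • y k) ≤ F (k + 1) - F k := by
      intro k _
      have h1 := two_mul_reDot_le hμ0 (y k) (y (k + 1))
      have h2 : F (k + 1) - F k = ((μ⁻¹) ^ 2) ^ k *
          ((μ⁻¹ * reDot (y (k + 1)) (y (k + 1)) - μ * reDot (y k) (y k)) / 2) := by
        simp only [hF, pow_succ]
        field_simp
      rw [h2, hre, reDot_add_right, reDot_complex_smul_self, hre, inv_neg, neg_sq]
      gcongr
      linarith
    refine (Finset.sum_le_sum hterm).trans ?_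
    rw [Finset.sum_range_sub]
    have hFN : F N = 0 := by simp [hF, hN, reDot]
    have hF0 : 0 ≤ F 0 := by
      have := reDot_self_nonneg (y 0)
      simp only [hF]
      positivity
    linarith

/-- For symmetric `P`, `xᵀ (P A + Aᵀ P) x = 2 xᵀ P A x`, so the Lyapunov inequality can be tested on
the bilinear form alone. -/
theorem SatSync.isLyapunovMatrix_of_form {A : Matrix (Fin n) (Fin n) ℝ}
    (b : (Fin n → ℝ) →ₗ[ℝ] (Fin n → ℝ) →ₗ[ℝ] ℝ) (hsymm : ∀ x y, b x y = b y x)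
    (hpos : ∀ x, x ≠ 0 → 0 < b x x) (hA : ∀ x, b x (A *ᵥ x) ≤ 0) :
    SatSync.IsLyapunovMatrix A (LinearMap.toMatrix₂' ℝ b) := by
  set P := LinearMap.toMatrix₂' ℝ b with hP
  have hb : ∀ x y, b x y = x ⬝ᵥ P *ᵥ y := by
    intro x y
    rw [← Matrix.toLinearMap₂'_apply', hP, Matrix.toLinearMap₂'_toMatrix']
  have hPT : Pᵀ = P := by
    ext i j
    simp only [transpose_apply, hP, LinearMap.toMatrix₂'_apply]
    exact hsymm _ _
  have hherm : P.IsHermitian := by rw [IsHermitian, conjTranspose_eq_transpose_of_trivial, hPT]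
  refine ⟨PosDef.of_dotProduct_mulVec_pos hherm fun x hx => ?_,
    PosSemidef.of_dotProduct_mulVec_nonneg ?_ fun x => ?_⟩
  · simpa [hb] using hpos x hx
  · rw [IsHermitian, conjTranspose_eq_transpose_of_trivial]
    simp [hPT, transpose_mul, add_comm]
  · have h1 : x ⬝ᵥ (Aᵀ * P) *ᵥ x = x ⬝ᵥ (P * A) *ᵥ x := by
      conv_lhs => rw [dotProduct_mulVec, ← mulVec_transpose, dotProduct_comm]
      simp [transpose_mul, hPT]
    have h2 : x ⬝ᵥ (P * A) *ᵥ x = b x (A *ᵥ x) := by rw [hb, mulVec_mulVec]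
    have := hA x
    simp only [star_trivial, neg_mulVec, add_mulVec, dotProduct_neg, dotProduct_add, h1, h2]
    linarith

/-- The componentwise inclusion `ℝⁿ → ℂⁿ`. -/
noncomputable def complexifyVec : (Fin n → ℝ) →ₗ[ℝ] (Fin n → ℂ) where
  toFun x i := x i
  map_add' x y := by ext; simp
  map_smul' c x := by ext; simp

theorem complexifyVec_mulVec (A : Matrix (Fin n) (Fin n) ℝ) (x : Fin n → ℝ) :
    complexifyVec (A *ᵥ x) = Matrix.toLin' (A.map Complex.ofReal) (complexifyVec x) := by
  ext i
  simp [complexifyVec, mulVec, dotProduct]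

theorem complexifyVec_injective : Function.Injective (complexifyVec (n := n)) := by
  intro x y h
  ext i
  simpa [complexifyVec] using congrFun h i

/-- A neutrally stable matrix has a quadratic Lyapunov function. -/
theorem SatSync.IsNeutrallyStable.exists_isLyapunovMatrix {A : Matrix (Fin n) (Fin n) ℝ}
    (hA : SatSync.IsNeutrallyStable A) : ∃ P, SatSync.IsLyapunovMatrix A P := by
  set f : Module.End ℂ (Fin n → ℂ) := Matrix.toLin' (A.map Complex.ofReal) with hf
  obtain ⟨R, p, N, hR, hnil, hinj⟩ := f.exists_polynomial_family
  set g : ℂ → ℕ → (Fin n → ℝ) →ₗ[ℝ] (Fin n → ℂ) := fun z k =>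
    (((f - algebraMap ℂ _ z) ^ k * Polynomial.aeval f (p z)).restrictScalars ℝ) ∘ₗ complexifyVec
    with hg
  -- When `z.re = 0` the convention `0⁻¹ = 0` leaves weight `1` at `k = 0` and `0` afterwards.
  set c : ℂ → ℕ → ℝ := fun z k => ((z.re⁻¹) ^ 2) ^ k with hc
  have hc0 : ∀ z k, 0 ≤ c z k := fun z k => by positivity
  -- The chain already vanishes at index `N`; the range `N + 1` guarantees that `k = 0` is present,
  -- which positivity needs.
  set b : (Fin n → ℝ) →ₗ[ℝ] (Fin n → ℝ) →ₗ[ℝ] ℝ := LinearMap.mk₂ ℝ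
    (fun x y => ∑ z ∈ R, ∑ k ∈ Finset.range (N + 1), c z k * reDot (g z k x) (g z k y))
    (fun x y w => by simp only [map_add, reDot_add_left, mul_add, Finset.sum_add_distrib])
    (fun r x y => by
      simp only [map_smul, reDot_smul_left, Finset.mul_sum, smul_eq_mul, mul_left_comm])
    (fun x y w => by simp only [map_add, reDot_add_right, mul_add, Finset.sum_add_distrib])
    (fun r x y => by
      simp only [map_smul, reDot_smul_right, Finset.mul_sum, smul_eq_mul, mul_left_comm])
    with hb
  have hb_apply : ∀ x y, b x y =
      ∑ z ∈ R, ∑ k ∈ Finset.range (N + 1), c z k * reDot (g z k x) (g z k y) := fun x y => rfl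
  have hgsucc : ∀ z k x, g z (k + 1) x = f (g z k x) - z • g z k x := by
    intro z k x
    simp [hg, pow_succ']
  have hgN : ∀ z ∈ R, ∀ x, g z N x = 0 := fun z hz x => hnil z hz _
  have hgA : ∀ z k x, g z k (A *ᵥ x) = f (g z k x) := by
    intro z k x
    have hcomm : Commute f ((f - algebraMap ℂ _ z) ^ k * Polynomial.aeval f (p z)) := by
      refine Commute.mul_right (Commute.pow_right (Commute.sub_right (Commute.refl f)
        (Algebra.commute_algebraMap_right z f)) k) ?_
      simpa using (Commute.all Polynomial.X (p z)).map (Polynomial.aeval f)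
    have h := congrArg (fun q : Module.End ℂ (Fin n → ℂ) => q (complexifyVec x)) hcomm.eq
    simp only [hg, LinearMap.comp_apply, complexifyVec_mulVec]
    exact h.symm
  refine ⟨_, SatSync.isLyapunovMatrix_of_form b (fun x y => ?_) (fun x hx => ?_) (fun x => ?_)⟩
  · simp only [hb_apply, reDot_comm]
  · have hnonneg : ∀ z ∈ R, ∀ k ∈ Finset.range (N + 1),
        0 ≤ c z k * reDot (g z k x) (g z k x) := fun z _ k _ =>
      mul_nonneg (hc0 z k) (reDot_self_nonneg _)
    obtain ⟨z, hz, hzx⟩ : ∃ z ∈ R, g z 0 x ≠ 0 := by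
      by_contra! h
      refine hx (complexifyVec_injective ?_)
      rw [map_zero]
      exact hinj _ fun z hz => by simpa [hg] using h z hz
    rw [hb_apply]
    refine Finset.sum_pos' (fun z hz => Finset.sum_nonneg (hnonneg z hz)) ⟨z, hz, ?_⟩
    refine Finset.sum_pos' (hnonneg z hz) ⟨0, by simp, ?_⟩
    simpa [hc] using reDot_self_pos hzx
  · rw [hb_apply]
    refine Finset.sum_nonpos fun z hz => ?_
    have hsz := hA z (hR z hz)
    have h1 : ∀ k, g z k (A *ᵥ x) = g z (k + 1) x + z • g z k x := fun k => by
      rw [hgA, hgsucc, sub_add_cancel]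
    simp only [h1]
    refine sum_reDot_chain_nonpos hsz.1 (fun k => g z k x) ?_ fun hre k => ?_
    · simp [hgsucc, hgN z hz]
    -- On the imaginary axis each chain vector is a generalized eigenvector, hence by
    -- semi-simplicity an eigenvector, and the next chain vector is zero.
    · have hk : ∀ k, f (g z k x) = z • g z k x := by
        intro k
        rw [← Module.End.mem_eigenspace_iff, ← hsz.2 hre, Module.End.mem_maxGenEigenspace]
        refine ⟨N, ?_⟩
        have h2 : (f - z • (1 : Module.End ℂ (Fin n → ℂ))) = f - algebraMap ℂ _ z := by
          rw [Algebra.algebraMap_eq_smul_one]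
        rw [h2]
        have h3 : ((f - algebraMap ℂ _ z) ^ N) (g z k x) =
            ((f - algebraMap ℂ _ z) ^ k) (g z N x) := by
          have h4 : (f - algebraMap ℂ _ z) ^ N *
              ((f - algebraMap ℂ _ z) ^ k * Polynomial.aeval f (p z)) =
              (f - algebraMap ℂ _ z) ^ k *
              ((f - algebraMap ℂ _ z) ^ N * Polynomial.aeval f (p z)) := by
            rw [← mul_assoc, ← mul_assoc, ← pow_add, ← pow_add, add_comm]
          exact congrArg (fun q : Module.End ℂ (Fin n → ℂ) => q (complexifyVec x)) h4
        rw [h3, hgN z hz, map_zero]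
      rw [hgsucc, hk, sub_self]

end LyapunovExistence

/-! ### Grounded Laplacians and the weights `γ` -/

section Graph

namespace SatSync

variable {N : ℕ}

/-- The map `v ↦ (∑ⱼ aᵢⱼ (vᵢ - vⱼ) + cᵢ vᵢ)ᵢ`, a grounded Laplacian. -/
noncomputable def WeightedGraph.groundedLaplacian (G : WeightedGraph N) (c : Fin N → ℝ) :
    (Fin N → ℝ) →ₗ[ℝ] (Fin N → ℝ) where
  toFun v i := ∑ j, G.a i j * (v i - v j) + c i * v i
  map_add' v w := by
    ext i
    simp only [Pi.add_apply, add_sub_add_comm, mul_add, Finset.sum_add_distrib]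
    ring
  map_smul' r v := by
    ext i
    simp only [Pi.smul_apply, smul_eq_mul, ← mul_sub, mul_left_comm _ r, ← Finset.mul_sum,
      RingHom.id_apply]
    ring

/-- The minimum principle for the grounded Laplacian. -/
theorem WeightedGraph.IsRootedIn.nonneg_of_groundedLaplacian_nonneg {G : WeightedGraph N}
    {S : Set (Fin N)} (hG : G.IsRootedIn S) {c : Fin N → ℝ} (hc : ∀ i, 0 ≤ c i)
    (hcS : ∀ i ∈ S, 0 < c i) {v : Fin N → ℝ} (hv : ∀ i, 0 ≤ G.groundedLaplacian c v i)
    (i : Fin N) : 0 ≤ v i := by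
  have : Nonempty (Fin N) := ⟨i⟩
  obtain ⟨k, hk⟩ := Finite.exists_min v
  refine le_trans ?_ (hk i)
  by_contra! hneg
  -- At a negative minimum every summand is nonpositive while the sum is nonnegative, so all vanish:
  -- the minimum spreads to in-neighbours and forces `c = 0` there. Following a path back to a root
  -- contradicts `c > 0`.
  have hmin : ∀ l, v l = v k → (∀ j, 0 < G.a l j → v j = v k) ∧ c l = 0 := by
    intro l hl
    have h1 : ∀ j ∈ Finset.univ, G.a l j * (v l - v j) ≤ 0 := fun j _ =>
      mul_nonpos_of_nonneg_of_nonpos (G.nonneg l j) (by linarith [hk j])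
    have h2 : c l * v l ≤ 0 := mul_nonpos_of_nonneg_of_nonpos (hc l) (by linarith)
    have h3 : 0 ≤ ∑ j, G.a l j * (v l - v j) + c l * v l := hv l
    have h4 := Finset.sum_nonpos h1
    constructor
    · intro j hj
      have h5 := (Finset.sum_eq_zero_iff_of_nonpos h1).1 (by linarith) j (Finset.mem_univ j)
      rcases mul_eq_zero.1 h5 with h | h <;> linarith
    · have h5 : c l * v l = 0 := by linarith
      rcases mul_eq_zero.1 h5 with h | h
      · exact h
      · linarith
  obtain ⟨r, hr, hpath⟩ := hG k
  have hback : v r = v k := by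
    clear hr
    induction hpath using Relation.ReflTransGen.head_induction_on with
    | refl => rfl
    | head hab _ ih => exact (hmin _ ih).1 _ hab
  exact (hcS r hr).ne' (hmin r hback).2

/-- There is a positive left vector `γ` with `γᵀ L = 𝟙ᵀ` for the grounded Laplacian `L`. -/
theorem WeightedGraph.IsRootedIn.exists_weight {G : WeightedGraph N} {S : Set (Fin N)}
    (hG : G.IsRootedIn S) {c : Fin N → ℝ} (hc : ∀ i, 0 ≤ c i) (hcS : ∀ i ∈ S, 0 < c i) :
    ∃ γ : Fin N → ℝ, (∀ i, 0 < γ i) ∧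
      ∀ v : Fin N → ℝ, ∑ i, γ i * (∑ j, G.a i j * (v i - v j) + c i * v i) = ∑ i, v i := by
  set L := G.groundedLaplacian c with hL
  have hinj : Function.Injective L := by
    rw [injective_iff_map_eq_zero]
    intro v hv
    ext i
    have h1 := hG.nonneg_of_groundedLaplacian_nonneg hc hcS (v := v) (fun i => by simp [← hL, hv]) i
    have h2 := hG.nonneg_of_groundedLaplacian_nonneg hc hcS (v := -v)
      (fun i => by simp [← hL, hv]) i
    simp only [Pi.neg_apply, Pi.zero_apply] at h2 ⊢
    linarith
  -- `u i` is the `i`-th column of `L⁻¹`, nonnegative by the minimum principle; its sum will be `γ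
  -- i`, that is `γᵀ = 𝟙ᵀ L⁻¹`.
  choose u hu using fun i : Fin N => (LinearMap.injective_iff_surjective.1 hinj) (Pi.single i 1)
  have hu0 : ∀ i k, 0 ≤ u i k := fun i =>
    hG.nonneg_of_groundedLaplacian_nonneg hc hcS fun k => by
      rw [← hL, hu]
      exact (Pi.single_nonneg (α := fun _ => ℝ).2 zero_le_one) k
  refine ⟨fun i => ∑ k, u i k, fun i => ?_, fun v => ?_⟩
  · refine (Finset.sum_nonneg fun k _ => hu0 i k).lt_of_ne fun h => ?_
    have h1 : u i = 0 := by
      ext k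
      exact (Finset.sum_eq_zero_iff_of_nonneg fun k _ => hu0 i k).1 h.symm k (Finset.mem_univ k)
    have h2 := hu i
    rw [h1, map_zero] at h2
    simpa using congrFun h2 i
  · have hv : v = ∑ i, L v i • u i := by
      apply hinj
      rw [map_sum]
      simp only [map_smul, hu]
      exact pi_eq_sum_univ' (L v)
    conv_rhs => rw [hv]
    simp only [Finset.sum_apply, Pi.smul_apply, smul_eq_mul]
    rw [Finset.sum_comm]
    refine Finset.sum_congr rfl fun i _ => ?_
    rw [← Finset.mul_sum, mul_comm]
    rfl

end SatSync

end Graph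

/-! ### Comparison of quadratic forms -/

section QuadraticForms

variable {n : ℕ}

/-- A positive definite quadratic form dominates every other one. -/
theorem Matrix.PosDef.exists_dotProduct_mulVec_le {P : Matrix (Fin n) (Fin n) ℝ} (hP : P.PosDef)
    (S : Matrix (Fin n) (Fin n) ℝ) :
    ∃ κ : ℝ, 0 ≤ κ ∧ ∀ x : Fin n → ℝ, x ⬝ᵥ S *ᵥ x ≤ κ * (x ⬝ᵥ P *ᵥ x) := by
  have hcont : ∀ M : Matrix (Fin n) (Fin n) ℝ, Continuous fun x : Fin n → ℝ => x ⬝ᵥ M *ᵥ x :=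
    fun M => by fun_prop
  have hpos : ∀ x ∈ Metric.sphere (0 : Fin n → ℝ) 1, 0 < x ⬝ᵥ P *ᵥ x := fun x hx =>
    hP.dotProduct_mulVec_pos (ne_zero_of_mem_unit_sphere ⟨x, hx⟩)
  have hdiv : ContinuousOn (fun x : Fin n → ℝ => (x ⬝ᵥ S *ᵥ x) / (x ⬝ᵥ P *ᵥ x))
      (Metric.sphere 0 1) :=
    (hcont S).continuousOn.div (hcont P).continuousOn fun x hx => (hpos x hx).ne'
  obtain ⟨κ, hκ⟩ := ((isCompact_sphere (0 : Fin n → ℝ) 1).image_of_continuousOn hdiv).bddAbove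
  refine ⟨max κ 0, le_max_right _ _, fun x => ?_⟩
  rcases eq_or_ne x 0 with rfl | hx
  · simp
  have hx' : ‖x‖ ≠ 0 := norm_ne_zero_iff.2 hx
  set y : Fin n → ℝ := ‖x‖⁻¹ • x with hy
  have hys : y ∈ Metric.sphere (0 : Fin n → ℝ) 1 := by
    simp [hy, norm_smul, hx']
  have hxy : x = ‖x‖ • y := by simp [hy, smul_smul, hx']
  have h1 : (y ⬝ᵥ S *ᵥ y) / (y ⬝ᵥ P *ᵥ y) ≤ max κ 0 :=
    (hκ ⟨y, hys, rfl⟩).trans (le_max_left _ _)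
  rw [div_le_iff₀ (hpos y hys)] at h1
  have h2 : ∀ M : Matrix (Fin n) (Fin n) ℝ, x ⬝ᵥ M *ᵥ x = ‖x‖ ^ 2 * (y ⬝ᵥ M *ᵥ y) := by
    intro M
    conv_lhs => rw [hxy]
    simp only [mulVec_smul, dotProduct_smul, smul_dotProduct, smul_eq_mul]
    ring
  rw [h2, h2, mul_left_comm]
  gcongr

end QuadraticForms

/-! ### Properties of the saturation -/

section Saturation

namespace SatSync

theorem sat_eq_max_min (w : ℝ) : sat w = max (-1) (min 1 w) := by
  rcases lt_trichotomy w 0 with h | rfl | h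
  · rw [sat, Real.sign_of_neg h, abs_of_neg h, min_eq_right (a := 1) (by linarith : w ≤ 1)]
    rcases le_total 1 (-w) with h1 | h1
    · rw [min_eq_left h1, max_eq_left (by linarith)]; ring
    · rw [min_eq_right h1, max_eq_right (by linarith)]; ring
  · simp [sat]
  · rw [sat, Real.sign_of_pos h, abs_of_pos h, one_mul, max_eq_right]
    exact le_min (by norm_num) (by linarith)

theorem lipschitzWith_sat : LipschitzWith 1 sat := by
  have h : sat = fun w => max (-1) (min 1 w) := funext sat_eq_max_min
  rw [h]
  exact (LipschitzWith.id.const_min 1).const_max (-1)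

theorem lipschitzWith_satVec {m : ℕ} : LipschitzWith 1 (satVec (m := m)) :=
  LipschitzWith.of_dist_le_mul fun v w => by
    rw [NNReal.coe_one, one_mul, dist_pi_le_iff dist_nonneg]
    intro k
    have h := lipschitzWith_sat.dist_le_mul (v k) (w k)
    rw [NNReal.coe_one, one_mul] at h
    exact h.trans (dist_le_pi_dist v w k)

theorem sat_neg (w : ℝ) : sat (-w) = -sat w := by
  simp only [sat, abs_neg]
  rcases lt_trichotomy w 0 with h | rfl | h
  · rw [Real.sign_of_neg h, Real.sign_of_pos (by linarith)]; ring
  · simp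
  · rw [Real.sign_of_pos h, Real.sign_of_neg (by linarith)]; ring

theorem satVec_neg {m : ℕ} (v : Fin m → ℝ) : satVec (-v) = -satVec v :=
  funext fun k => sat_neg (v k)

/-- The saturation is a sector nonlinearity. -/
theorem sat_sq_le (w : ℝ) : sat w ^ 2 ≤ w * sat w := by
  rw [sat_eq_max_min]
  rcases max_cases (-1) (min 1 w) with h | h <;> rcases min_cases 1 w with h' | h' <;> nlinarith

theorem sat_eq_self {w : ℝ} (h : |sat w| < 1) : sat w = w := by
  rw [sat_eq_max_min] at h ⊢
  rw [abs_lt] at h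
  rcases max_cases (-1) (min 1 w) with h1 | h1 <;> rcases min_cases 1 w with h' | h' <;> linarith

-- Once `|sat w| < 1` the saturation is inactive and `sat w = w`.
open Filter Topology in
theorem tendsto_zero_of_tendsto_sat {α : Type*} {l : Filter α} {w : α → ℝ}
    (h : Tendsto (fun a => sat (w a)) l (𝓝 0)) : Tendsto w l (𝓝 0) := by
  refine h.congr' ?_
  filter_upwards [Metric.tendsto_nhds.1 h 1 one_pos] with a ha
  exact sat_eq_self (by simpa using ha)

end SatSync

end Saturation

section

open Filter Set Topology

/-! ### Existence of closed-loop trajectories -/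

section Existence

/-- Lipschitz with some constant. -/
def IsLip {E F : Type*} [PseudoEMetricSpace E] [PseudoEMetricSpace F] (f : E → F) : Prop :=
  ∃ K : NNReal, LipschitzWith K f

namespace IsLip

variable {E F H : Type*} [PseudoEMetricSpace E]

theorem comp [PseudoEMetricSpace F] [PseudoEMetricSpace H] {g : F → H} {f : E → F} (hg : IsLip g)
    (hf : IsLip f) : IsLip fun x => g (f x) := by
  obtain ⟨K, hK⟩ := hg
  obtain ⟨L, hL⟩ := hf
  exact ⟨_, hK.comp hL⟩

theorem prodMk [PseudoEMetricSpace F] [PseudoEMetricSpace H] {f : E → F} {g : E → H}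
    (hf : IsLip f) (hg : IsLip g) : IsLip fun x => (f x, g x) := by
  obtain ⟨K, hK⟩ := hf
  obtain ⟨L, hL⟩ := hg
  exact ⟨_, hK.prodMk hL⟩

theorem pi {ι : Type*} [Fintype ι] {Y : ι → Type*} [∀ i, PseudoEMetricSpace (Y i)]
    {f : E → ∀ i, Y i} (hf : ∀ i, IsLip fun x => f x i) : IsLip f := by
  choose K hK using hf
  refine ⟨Finset.univ.sup K, fun x y => edist_pi_le_iff.2 fun i => (hK i x y).trans ?_⟩
  gcongr
  exact Finset.le_sup (Finset.mem_univ i)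

theorem eval {ι : Type*} [Fintype ι] {Y : ι → Type*} [∀ i, PseudoEMetricSpace (Y i)]
    {f : E → ∀ i, Y i} (hf : IsLip f) (i : ι) : IsLip fun x => f x i :=
  comp ⟨1, LipschitzWith.eval i⟩ hf

theorem add [SeminormedAddCommGroup F] {f g : E → F} (hf : IsLip f) (hg : IsLip g) :
    IsLip fun x => f x + g x := by
  obtain ⟨K, hK⟩ := hf
  obtain ⟨L, hL⟩ := hg
  exact ⟨_, hK.add hL⟩

theorem sub [SeminormedAddCommGroup F] {f g : E → F} (hf : IsLip f) (hg : IsLip g) :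
    IsLip fun x => f x - g x := by
  obtain ⟨K, hK⟩ := hf
  obtain ⟨L, hL⟩ := hg
  exact ⟨_, hK.sub hL⟩

theorem sum [SeminormedAddCommGroup F] {ι : Type*} (s : Finset ι) {f : ι → E → F}
    (hf : ∀ i, IsLip (f i)) : IsLip fun x => ∑ i ∈ s, f i x := by
  classical
  induction s using Finset.induction_on with
  | empty => exact ⟨0, by simpa using LipschitzWith.const (0 : F)⟩
  | insert i s hi ih =>
    simp only [Finset.sum_insert hi]
    exact (hf i).add ih

theorem const_smul [NormedAddCommGroup F] [NormedSpace ℝ F] {f : E → F} (hf : IsLip f) (c : ℝ) :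
    IsLip fun x => c • f x :=
  comp ⟨_, lipschitzWith_smul c⟩ hf

theorem mulVec {k l : ℕ} (M : Matrix (Fin k) (Fin l) ℝ) {f : E → Fin l → ℝ} (hf : IsLip f) :
    IsLip fun x => M *ᵥ f x :=
  comp ⟨_, (LinearMap.toContinuousLinearMap (Matrix.mulVecLin M)).lipschitz⟩ hf

end IsLip

namespace SatSync

variable {n m q N : ℕ}

theorem isLip_satVec {E : Type*} [PseudoEMetricSpace E] {f : E → Fin m → ℝ} (hf : IsLip f) :
    IsLip fun x => satVec (f x) :=
  IsLip.comp ⟨1, lipschitzWith_satVec⟩ hf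

theorem WeightedGraph.isLip_exchange (G : WeightedGraph N) {k : ℕ} {E : Type*}
    [PseudoEMetricSpace E] {f : E → Fin N → Fin k → ℝ} (hf : IsLip f) (i : Fin N) :
    IsLip fun x => G.exchange (f x) i :=
  IsLip.sum _ fun j => ((hf.eval i).sub (hf.eval j)).const_smul _

/-- Closed-loop solutions exist globally, for every linear protocol. -/
theorem exists_isClosedLoopSolution (A : Matrix (Fin n) (Fin n) ℝ) (B : Matrix (Fin n) (Fin m) ℝ)
    (C : Matrix (Fin q) (Fin n) ℝ) (K : LinearProtocol n m q) (G : WeightedGraph N)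
    (S : Set (Fin N)) (xr0 : Fin n → ℝ) (x0 : Fin N → Fin n → ℝ) (xc0 : Fin N → Fin K.nc → ℝ) :
    ∃ xr x xc, IsClosedLoopSolution A B C K G S xr x xc ∧ xr 0 = xr0 ∧ x 0 = x0 ∧ xc 0 = xc0 := by
  let E := (Fin n → ℝ) × (Fin N → Fin n → ℝ) × (Fin N → Fin K.nc → ℝ)
  let F : E → E := fun z =>
    (A *ᵥ z.1, fun i => A *ᵥ z.2.1 i + B *ᵥ satVec (K.Fc *ᵥ z.2.2 i),
      fun i => K.Ac *ᵥ z.2.2 i + rootIndicator S i • (K.Ec *ᵥ z.2.2 i)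
      + K.Bc *ᵥ satVec (K.Fc *ᵥ z.2.2 i)
      + K.Cc *ᵥ G.regulatedExchange S (fun j => C *ᵥ z.2.1 j) (C *ᵥ z.1) i
      + K.Dc *ᵥ G.exchange (fun j => K.Hc *ᵥ z.2.2 j) i)
  have h1 : IsLip fun z : E => z.1 := ⟨1, LipschitzWith.prod_fst⟩
  have h2 : IsLip fun z : E => z.2.1 := IsLip.comp ⟨1, LipschitzWith.prod_fst⟩
    ⟨1, LipschitzWith.prod_snd⟩
  have h3 : IsLip fun z : E => z.2.2 := IsLip.comp ⟨1, LipschitzWith.prod_snd⟩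
    ⟨1, LipschitzWith.prod_snd⟩
  have hu : ∀ i, IsLip fun z : E => satVec (K.Fc *ᵥ z.2.2 i) := fun i =>
    isLip_satVec ((h3.eval i).mulVec _)
  have hy : IsLip fun z : E => fun j => C *ᵥ z.2.1 j := IsLip.pi fun j => (h2.eval j).mulVec _
  have hξ : IsLip fun z : E => fun j => K.Hc *ᵥ z.2.2 j := IsLip.pi fun j => (h3.eval j).mulVec _
  have hreg : ∀ i, IsLip fun z : E =>
      G.regulatedExchange S (fun j => C *ᵥ z.2.1 j) (C *ᵥ z.1) i := fun i =>
    (G.isLip_exchange hy i).add (((hy.eval i).sub (h1.mulVec C)).const_smul _)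
  obtain ⟨L, hL⟩ : IsLip F := by
    refine (h1.mulVec A).prodMk (IsLip.prodMk (IsLip.pi fun i => ?_) (IsLip.pi fun i => ?_))
    · exact ((h2.eval i).mulVec A).add ((hu i).mulVec B)
    · exact (((((h3.eval i).mulVec _).add (((h3.eval i).mulVec _).const_smul _)).add
        ((hu i).mulVec _)).add ((hreg i).mulVec _)).add ((G.isLip_exchange hξ i).mulVec _)
  obtain ⟨α, hα0, hα⟩ := hL.exists_solution_Ici (xr0, x0, xc0)
  refine ⟨fun t => (α t).1, fun t => (α t).2.1, fun t => (α t).2.2,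
    ⟨fun t ht => ?_, fun i t ht => ?_, fun i t ht => ?_⟩, by simp [hα0], by simp [hα0],
    by simp [hα0]⟩
  · exact (hα t ht).fst
  · exact hasDerivWithinAt_pi.1 (hα t ht).snd.fst i
  · exact hasDerivWithinAt_pi.1 (hα t ht).snd.snd i

end SatSync

end Existence

/-! ### Derivatives and limits of quadratic forms -/

section Calculus

variable {n k : ℕ}

theorem HasDerivWithinAt.matrix_mulVec (M : Matrix (Fin k) (Fin n) ℝ) {y : ℝ → Fin n → ℝ}
    {y' : Fin n → ℝ} {s : Set ℝ} {t : ℝ} (h : HasDerivWithinAt y y' s t) :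
    HasDerivWithinAt (fun τ => M *ᵥ y τ) (M *ᵥ y') s t :=
  (LinearMap.toContinuousLinearMap (Matrix.mulVecLin M)).hasFDerivAt.comp_hasDerivWithinAt t h

theorem HasDerivWithinAt.dotProduct_real {y z : ℝ → Fin n → ℝ} {y' z' : Fin n → ℝ} {s : Set ℝ}
    {t : ℝ} (hy : HasDerivWithinAt y y' s t) (hz : HasDerivWithinAt z z' s t) :
    HasDerivWithinAt (fun τ => y τ ⬝ᵥ z τ) (y' ⬝ᵥ z t + y t ⬝ᵥ z') s t := by
  have h := HasDerivWithinAt.fun_sum (u := Finset.univ) fun i _ =>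
    (hasDerivWithinAt_pi.1 hy i).mul (hasDerivWithinAt_pi.1 hz i)
  rw [Finset.sum_add_distrib] at h
  exact h

theorem Matrix.IsHermitian.dotProduct_mulVec_comm_real {P : Matrix (Fin n) (Fin n) ℝ}
    (hP : P.IsHermitian) (x y : Fin n → ℝ) : x ⬝ᵥ P *ᵥ y = y ⬝ᵥ P *ᵥ x := by
  have h : Pᵀ = P := by rw [← conjTranspose_eq_transpose_of_trivial]; exact hP
  rw [dotProduct_mulVec, ← mulVec_transpose, h, dotProduct_comm]

theorem HasDerivWithinAt.quadraticForm {P : Matrix (Fin n) (Fin n) ℝ} (hP : P.IsHermitian)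
    {y : ℝ → Fin n → ℝ} {y' : Fin n → ℝ} {s : Set ℝ} {t : ℝ} (hy : HasDerivWithinAt y y' s t) :
    HasDerivWithinAt (fun τ => y τ ⬝ᵥ P *ᵥ y τ) (2 * (y t ⬝ᵥ P *ᵥ y')) s t := by
  have h := hy.dotProduct_real (hy.matrix_mulVec P)
  rw [hP.dotProduct_mulVec_comm_real y' (y t), ← two_mul] at h
  exact h

theorem Filter.Tendsto.matrix_mulVec_zero {α : Type*} {l : Filter α}
    (M : Matrix (Fin k) (Fin n) ℝ) {y : α → Fin n → ℝ} (h : Tendsto y l (𝓝 0)) :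
    Tendsto (fun a => M *ᵥ y a) l (𝓝 0) := by
  have hc : Continuous fun x : Fin n → ℝ => M *ᵥ x := by fun_prop
  simpa [Function.comp_def] using (hc.tendsto 0).comp h

theorem tendsto_zero_of_dotProduct_self {α : Type*} {l : Filter α} {y : α → Fin n → ℝ}
    (h : Tendsto (fun a => y a ⬝ᵥ y a) l (𝓝 0)) : Tendsto y l (𝓝 0) := by
  rw [tendsto_pi_nhds]
  intro i
  have h1 : Tendsto (fun a => y a i ^ 2) l (𝓝 0) := by
    refine squeeze_zero (fun a => sq_nonneg _) (fun a => ?_) h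
    rw [sq]
    exact Finset.single_le_sum (f := fun i => y a i * y a i) (fun i _ => mul_self_nonneg _)
      (Finset.mem_univ i)
  have h2 := h1.sqrt
  simp only [Real.sqrt_sq_eq_abs, Real.sqrt_zero] at h2
  exact (tendsto_zero_iff_abs_tendsto_zero _).2 h2

theorem Matrix.PosDef.tendsto_zero_of_quadraticForm {α : Type*} {l : Filter α}
    {P : Matrix (Fin n) (Fin n) ℝ} (hP : P.PosDef) {y : α → Fin n → ℝ}
    (h : Tendsto (fun a => y a ⬝ᵥ P *ᵥ y a) l (𝓝 0)) : Tendsto y l (𝓝 0) := by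
  obtain ⟨κ, -, hκ⟩ := hP.exists_dotProduct_mulVec_le 1
  simp only [one_mulVec] at hκ
  refine tendsto_zero_of_dotProduct_self (squeeze_zero (fun a => ?_) (fun a => hκ (y a)) ?_)
  · exact Finset.sum_nonneg fun i _ => mul_self_nonneg _
  · simpa using h.const_mul κ

open scoped MatrixOrder Matrix.Norms.L2Operator in
theorem Matrix.PosSemidef.exists_eq_transpose_mul_self {Q : Matrix (Fin n) (Fin n) ℝ}
    (hQ : Q.PosSemidef) : ∃ R : Matrix (Fin n) (Fin n) ℝ, Q = Rᵀ * R := by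
  obtain ⟨R, hR⟩ := CStarAlgebra.nonneg_iff_eq_star_mul_self.mp hQ.nonneg
  refine ⟨R, ?_⟩
  rw [hR, star_eq_conjTranspose, conjTranspose_eq_transpose_of_trivial]

/-- Writing `Q = Rᵀ R` turns the form into `|R y|²`, so `R y → 0` and then `Q y = Rᵀ R y → 0`. -/
theorem Matrix.PosSemidef.tendsto_mulVec_zero_of_quadraticForm {α : Type*} {l : Filter α}
    {Q : Matrix (Fin n) (Fin n) ℝ} (hQ : Q.PosSemidef) {y : α → Fin n → ℝ}
    (h : Tendsto (fun a => y a ⬝ᵥ Q *ᵥ y a) l (𝓝 0)) :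
    Tendsto (fun a => Q *ᵥ y a) l (𝓝 0) := by
  obtain ⟨R, hR⟩ := hQ.exists_eq_transpose_mul_self
  have h1 : ∀ x : Fin n → ℝ, x ⬝ᵥ Q *ᵥ x = (R *ᵥ x) ⬝ᵥ (R *ᵥ x) := fun x => by
    rw [hR, ← mulVec_mulVec, dotProduct_mulVec, vecMul_transpose]
  simp only [h1] at h
  simpa only [hR, mulVec_mulVec] using
    (tendsto_zero_of_dotProduct_self h).matrix_mulVec_zero Rᵀ

/-- Along a bounded trajectory of an autonomous ODE, continuous functions of the state are
uniformly continuous in time. -/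
theorem uniformContinuousOn_comp_of_bounded {E : Type*} [NormedAddCommGroup E] [NormedSpace ℝ E]
    [ProperSpace E] {f : E → E} (hf : Continuous f) {z : ℝ → E}
    (hz : ∀ t, 0 ≤ t → HasDerivWithinAt z (f (z t)) (Ici 0) t) {C : ℝ}
    (hC : ∀ t, 0 ≤ t → ‖z t‖ ≤ C) {h : E → ℝ} (hh : Continuous h) :
    UniformContinuousOn (fun t => h (z t)) (Ici 0) := by
  have hmem : MapsTo z (Ici 0) (Metric.closedBall 0 C) := fun t ht => by simpa using hC t ht
  obtain ⟨M, hM⟩ := (isCompact_closedBall (0 : E) C).exists_bound_of_continuousOn hf.continuousOn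
  -- Boundedness of the state bounds its velocity, so the trajectory is Lipschitz in time.
  have hlip : LipschitzOnWith M.toNNReal z (Ici 0) :=
    (convex_Ici 0).lipschitzOnWith_of_nnnorm_hasDerivWithin_le (fun t ht => hz t ht) fun t ht =>
      NNReal.coe_le_coe.1 ((hM _ (hmem ht)).trans (Real.le_coe_toNNReal M))
  exact ((isCompact_closedBall (0 : E) C).uniformContinuousOn_of_continuous hh.continuousOn).comp
    hlip.uniformContinuousOn hmem

end Calculus

end

section

open Filter Set Topology

/-! ### From vanishing outputs to vanishing state -/

section Observability

variable {n m k : ℕ}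

/-- If `y' = A y + r` with `r → 0`, then `M y → 0` implies `M A y → 0`. -/
theorem tendsto_mulVec_mulVec_of_tendsto_mulVec {A : Matrix (Fin n) (Fin n) ℝ}
    {y r : ℝ → Fin n → ℝ} (hy : ∀ t, 0 ≤ t → HasDerivWithinAt y (A *ᵥ y t + r t) (Ici 0) t)
    (hr : Tendsto r atTop (𝓝 0))
    (huc : ∀ h : (Fin n → ℝ) → ℝ, Continuous h → UniformContinuousOn (fun t => h (y t)) (Ici 0))
    (M : Matrix (Fin k) (Fin n) ℝ) (hM : Tendsto (fun t => M *ᵥ y t) atTop (𝓝 0)) :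
    Tendsto (fun t => (M * A) *ᵥ y t) atTop (𝓝 0) := by
  rw [tendsto_pi_nhds]
  intro i
  -- Barbalat is applied to a component of `M y`, whose derivative is that of `M A y` plus the
  -- vanishing `M r`.
  refine tendsto_zero_of_hasDerivWithinAt_add (g := fun t => (M *ᵥ y t) i)
    (r := fun t => (M *ᵥ r t) i) (fun t ht => ?_) (tendsto_pi_nhds.1 hM i)
    (tendsto_pi_nhds.1 (hr.matrix_mulVec_zero M) i) (huc (fun x => ((M * A) *ᵥ x) i) (by fun_prop))
  have h := hasDerivWithinAt_pi.1 ((hy t ht).matrix_mulVec M) i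
  rwa [mulVec_add, mulVec_mulVec] at h

theorem tendsto_mulVec_pow_of_tendsto_mulVec {A : Matrix (Fin n) (Fin n) ℝ}
    {y r : ℝ → Fin n → ℝ} (hy : ∀ t, 0 ≤ t → HasDerivWithinAt y (A *ᵥ y t + r t) (Ici 0) t)
    (hr : Tendsto r atTop (𝓝 0))
    (huc : ∀ h : (Fin n → ℝ) → ℝ, Continuous h → UniformContinuousOn (fun t => h (y t)) (Ici 0))
    (M : Matrix (Fin k) (Fin n) ℝ) (hM : Tendsto (fun t => M *ᵥ y t) atTop (𝓝 0)) (j : ℕ) :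
    Tendsto (fun t => (M * A ^ j) *ᵥ y t) atTop (𝓝 0) := by
  induction j with
  | zero => simpa using hM
  | succ j ih =>
    rw [pow_succ, ← Matrix.mul_assoc]
    exact tendsto_mulVec_mulVec_of_tendsto_mulVec hy hr huc _ ih

namespace SatSync

theorem IsControllable.exists_controllabilityMatrix_mul_eq_one {A : Matrix (Fin n) (Fin n) ℝ}
    {B : Matrix (Fin n) (Fin m) ℝ} (h : IsControllable A B) :
    ∃ X : Matrix (Fin n × Fin m) (Fin n) ℝ, controllabilityMatrix A B * X = 1 := by
  rw [← Matrix.mulVec_surjective_iff_exists_right_inverse]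
  have h1 : LinearMap.range (controllabilityMatrix A B).mulVecLin = ⊤ := by
    apply Submodule.eq_top_of_finrank_eq
    have h2 : Module.finrank ℝ (LinearMap.range (controllabilityMatrix A B).mulVecLin) = n := h
    simpa using h2
  exact LinearMap.range_eq_top.1 h1

/-- For a controllable pair, `w → 0` as soon as `Bᵀ (Aᵀ)ʲ w → 0` for all `j`. -/
theorem IsControllable.tendsto_zero {A : Matrix (Fin n) (Fin n) ℝ}
    {B : Matrix (Fin n) (Fin m) ℝ} (h : IsControllable A B) {α : Type*} {l : Filter α}
    {w : α → Fin n → ℝ} (hw : ∀ j : ℕ, Tendsto (fun a => (A ^ j * B)ᵀ *ᵥ w a) l (𝓝 0)) :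
    Tendsto w l (𝓝 0) := by
  obtain ⟨X, hX⟩ := IsControllable.exists_controllabilityMatrix_mul_eq_one h
  have h1 : Tendsto (fun a => (controllabilityMatrix A B)ᵀ *ᵥ w a) l (𝓝 0) := by
    rw [tendsto_pi_nhds]
    exact fun p => tendsto_pi_nhds.1 (hw p.1) p.2
  have hc : Continuous fun x : Fin n × Fin m → ℝ => Xᵀ *ᵥ x := by fun_prop
  have h2 := (hc.tendsto 0).comp h1
  simpa [Function.comp_def, ← transpose_mul, hX] using h2

/-- If `y' = A y + r`, `r → 0`, and both `Bᵀ P y → 0` and `(P A + Aᵀ P) y → 0`, then `y → 0`. -/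
theorem IsControllable.tendsto_zero_of_lyapunov {A P : Matrix (Fin n) (Fin n) ℝ}
    {B : Matrix (Fin n) (Fin m) ℝ} (h : IsControllable A B) (hP : P.PosDef)
    {y r : ℝ → Fin n → ℝ} (hy : ∀ t, 0 ≤ t → HasDerivWithinAt y (A *ᵥ y t + r t) (Ici 0) t)
    (hr : Tendsto r atTop (𝓝 0))
    (huc : ∀ h : (Fin n → ℝ) → ℝ, Continuous h → UniformContinuousOn (fun t => h (y t)) (Ici 0))
    (hB : Tendsto (fun t => (Bᵀ * P) *ᵥ y t) atTop (𝓝 0))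
    (hQ : Tendsto (fun t => (-(P * A + Aᵀ * P)) *ᵥ y t) atTop (𝓝 0)) :
    Tendsto y atTop (𝓝 0) := by
  have hBj := tendsto_mulVec_pow_of_tendsto_mulVec hy hr huc _ hB
  have hQj := tendsto_mulVec_pow_of_tendsto_mulVec hy hr huc _ hQ
  -- Up to vanishing terms `P A = -Aᵀ P` along `y`; iterating moves all powers of `A` across `P`.
  have hdiff : ∀ j : ℕ,
      Tendsto (fun t => (P * A ^ j - (-Aᵀ) ^ j * P) *ᵥ y t) atTop (𝓝 0) := by
    intro j
    induction j with
    | zero => simp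
    | succ j ih =>
      have h1 : P * A ^ (j + 1) - (-Aᵀ) ^ (j + 1) * P =
          -(-(P * A + Aᵀ * P) * A ^ j) + (-Aᵀ) * (P * A ^ j - (-Aᵀ) ^ j * P) := by
        rw [pow_succ' A, pow_succ' (-Aᵀ)]
        noncomm_ring
      have h2 : ∀ x : Fin n → ℝ, (P * A ^ (j + 1) - (-Aᵀ) ^ (j + 1) * P) *ᵥ x =
          -((-(P * A + Aᵀ * P) * A ^ j) *ᵥ x) + (-Aᵀ) *ᵥ ((P * A ^ j - (-Aᵀ) ^ j * P) *ᵥ x) :=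
        fun x => by rw [h1, add_mulVec, neg_mulVec, mulVec_mulVec]
      have h3 := (hQj j).neg.add (ih.matrix_mulVec_zero (-Aᵀ))
      rw [neg_zero, add_zero] at h3
      exact h3.congr fun t => (h2 (y t)).symm
  have hPy : Tendsto (fun t => P *ᵥ y t) atTop (𝓝 0) := by
    refine h.tendsto_zero fun j => ?_
    -- This trades `Bᵀ (Aᵀ)ʲ P y`, which controllability needs, for `Bᵀ P Aʲ y`, which is known to
    -- vanish.
    have h1 : (A ^ j * B)ᵀ * P =
        (-1 : ℝ) ^ j • (Bᵀ * P * A ^ j - Bᵀ * (P * A ^ j - (-Aᵀ) ^ j * P)) := by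
      have h2 : (-Aᵀ) ^ j = (-1 : ℝ) ^ j • (Aᵀ) ^ j := by
        rw [← neg_one_smul ℝ, smul_pow]
      rw [Matrix.mul_sub, ← Matrix.mul_assoc, sub_sub_cancel, h2, transpose_mul, transpose_pow,
        Matrix.smul_mul, Matrix.mul_smul, smul_smul, ← mul_pow, Matrix.mul_assoc]
      simp
    have h3 : ∀ x : Fin n → ℝ, (A ^ j * B)ᵀ *ᵥ (P *ᵥ x) = (-1 : ℝ) ^ j •
        ((Bᵀ * P * A ^ j) *ᵥ x - Bᵀ *ᵥ ((P * A ^ j - (-Aᵀ) ^ j * P) *ᵥ x)) := fun x => by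
      rw [mulVec_mulVec, h1, smul_mulVec, sub_mulVec, mulVec_mulVec]
    have h4 := ((hBj j).sub ((hdiff j).matrix_mulVec_zero Bᵀ)).const_smul ((-1 : ℝ) ^ j)
    rw [sub_zero, smul_zero] at h4
    exact h4.congr fun t => (h3 (y t)).symm
  have h1 := hPy.matrix_mulVec_zero P⁻¹
  have hdet : IsUnit P.det := (isUnit_iff_isUnit_det P).1 hP.isUnit
  simpa [mulVec_mulVec, nonsing_inv_mul P hdet] using h1

end SatSync

end Observability

/-! ### Dissipation inequalities -/

section ErrorSystem

namespace SatSync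

variable {n m N : ℕ}

/-- The quantity `vᵀ σ(ρ v)`. -/
noncomputable def satWork (ρ : ℝ) (v : Fin m → ℝ) : ℝ := v ⬝ᵥ satVec (ρ • v)

theorem satVec_sq_le {ρ : ℝ} (v : Fin m → ℝ) (k : Fin m) :
    satVec (ρ • v) k ^ 2 ≤ ρ * (v k * satVec (ρ • v) k) := by
  have := sat_sq_le (ρ * v k)
  simpa [satVec, mul_assoc] using this

theorem mul_satVec_nonneg {ρ : ℝ} (hρ : 0 < ρ) (v : Fin m → ℝ) (k : Fin m) :
    0 ≤ v k * satVec (ρ • v) k :=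
  nonneg_of_mul_nonneg_right ((sq_nonneg _).trans (satVec_sq_le v k)) hρ

theorem satWork_nonneg {ρ : ℝ} (hρ : 0 < ρ) (v : Fin m → ℝ) : 0 ≤ satWork ρ v := by
  unfold satWork dotProduct
  exact Finset.sum_nonneg fun k _ => mul_satVec_nonneg hρ v k

theorem continuous_satVec : Continuous (satVec (m := m)) := lipschitzWith_satVec.continuous

theorem continuous_satWork (ρ : ℝ) : Continuous (satWork (m := m) ρ) := by
  have h := continuous_satVec (m := m)
  unfold satWork
  fun_prop

/-- A Young-type estimate for the saturated feedback. -/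
theorem neg_two_mul_dotProduct_satVec_le {ρ : ℝ} (hρ : 0 < ρ) (v d : Fin m → ℝ) :
    -2 * ((v + d) ⬝ᵥ satVec (ρ • v)) ≤ -satWork ρ v + ρ * (d ⬝ᵥ d) := by
  have hk : ∀ k, -2 * ((v + d) k * satVec (ρ • v) k) ≤
      -(v k * satVec (ρ • v) k) + ρ * (d k * d k) := by
    intro k
    have h1 := satVec_sq_le (ρ := ρ) v k
    set s := satVec (ρ • v) k
    have h2 := sq_nonneg (ρ * d k + s)
    simp only [Pi.add_apply]
    -- By the sector bound `s² ≤ ρ v s`, the right-hand side is at least `(ρ d + s)²`.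
    have h3 : 0 ≤ ρ * (-(v k * s) + ρ * (d k * d k) - -2 * ((v k + d k) * s)) := by nlinarith
    have h4 := nonneg_of_mul_nonneg_right h3 hρ
    linarith
  simp only [satWork, dotProduct, Finset.mul_sum, ← Finset.sum_neg_distrib,
    ← Finset.sum_add_distrib]
  exact Finset.sum_le_sum fun k _ => hk k

/-- The sector bound gives `σ² ≤ ρ · satWork` in each component, so `σ → 0`; the saturation is then
eventually inactive and its argument vanishes too. -/
theorem tendsto_zero_of_tendsto_satWork {ρ : ℝ} (hρ : 0 < ρ) {α : Type*} {l : Filter α}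
    {v : α → Fin m → ℝ} (h : Tendsto (fun a => satWork ρ (v a)) l (𝓝 0)) :
    Tendsto v l (𝓝 0) ∧ Tendsto (fun a => satVec (ρ • v a)) l (𝓝 0) := by
  have hs : ∀ k, Tendsto (fun a => satVec (ρ • v a) k) l (𝓝 0) := by
    intro k
    have h1 : Tendsto (fun a => satVec (ρ • v a) k ^ 2) l (𝓝 0) := by
      refine squeeze_zero (fun a => sq_nonneg _) (fun a => (satVec_sq_le (v a) k).trans ?_)
        (by simpa using h.const_mul ρ)
      refine mul_le_mul_of_nonneg_left ?_ hρ.le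
      exact Finset.single_le_sum (f := fun k => v a k * satVec (ρ • v a) k)
        (fun k _ => mul_satVec_nonneg hρ (v a) k) (Finset.mem_univ k)
    have h2 := h1.sqrt
    simp only [Real.sqrt_sq_eq_abs, Real.sqrt_zero] at h2
    exact (tendsto_zero_iff_abs_tendsto_zero _).2 h2
  refine ⟨tendsto_pi_nhds.2 fun k => ?_, tendsto_pi_nhds.2 hs⟩
  have h1 := (tendsto_zero_of_tendsto_sat (hs k)).const_mul ρ⁻¹
  simpa [hρ.ne'] using h1

theorem lyapunov_quadraticForm_eq {A P : Matrix (Fin n) (Fin n) ℝ} (hP : P.IsHermitian)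
    (x : Fin n → ℝ) : 2 * (x ⬝ᵥ P *ᵥ (A *ᵥ x)) = -(x ⬝ᵥ (-(P * A + Aᵀ * P)) *ᵥ x) := by
  have h1 : x ⬝ᵥ (Aᵀ * P) *ᵥ x = x ⬝ᵥ (P * A) *ᵥ x := by
    rw [← mulVec_mulVec, dotProduct_mulVec, vecMul_transpose,
      hP.dotProduct_mulVec_comm_real, mulVec_mulVec]
  rw [neg_mulVec, add_mulVec, dotProduct_neg, dotProduct_add, h1, mulVec_mulVec]
  ring

/-- Dissipation of the agent energy. -/
theorem agent_energy_le {A P : Matrix (Fin n) (Fin n) ℝ} (B : Matrix (Fin n) (Fin m) ℝ)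
    (hP : P.IsHermitian) {ρ : ℝ} (hρ : 0 < ρ) (z e : Fin n → ℝ) :
    2 * (z ⬝ᵥ P *ᵥ (A *ᵥ z - B *ᵥ satVec (ρ • (Bᵀ * P) *ᵥ (z - e)))) ≤
      -(z ⬝ᵥ (-(P * A + Aᵀ * P)) *ᵥ z) - satWork ρ ((Bᵀ * P) *ᵥ (z - e))
        + ρ * (e ⬝ᵥ (P * B * (Bᵀ * P)) *ᵥ e) := by
  set v := (Bᵀ * P) *ᵥ (z - e) with hv
  set d := (Bᵀ * P) *ᵥ e with hd
  have hPT : Pᵀ = P := by rw [← conjTranspose_eq_transpose_of_trivial]; exact hP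
  have hadj : ∀ (x : Fin n → ℝ) (s : Fin m → ℝ), x ⬝ᵥ P *ᵥ (B *ᵥ s) = ((Bᵀ * P) *ᵥ x) ⬝ᵥ s := by
    intro x s
    rw [mulVec_mulVec, dotProduct_mulVec, ← mulVec_transpose, transpose_mul, hPT]
  have hvd : (Bᵀ * P) *ᵥ z = v + d := by rw [hv, hd, ← mulVec_add, sub_add_cancel]
  have hdd : e ⬝ᵥ (P * B * (Bᵀ * P)) *ᵥ e = d ⬝ᵥ d := by
    rw [← mulVec_mulVec, ← mulVec_mulVec, hadj]
  have h1 := neg_two_mul_dotProduct_satVec_le hρ v d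
  have h2 := lyapunov_quadraticForm_eq (A := A) hP z
  rw [mulVec_sub, dotProduct_sub, hadj, hvd, hdd, mul_sub, h2]
  linarith

/-- Dissipation of the observer energy. -/
theorem observer_energy_le {A P : Matrix (Fin n) (Fin n) ℝ} (hAP : IsLyapunovMatrix A P)
    (G : WeightedGraph N) (c : ℝ) (e : Fin N → Fin n → ℝ) (i : Fin N) :
    2 * (e i ⬝ᵥ P *ᵥ (A *ᵥ e i - G.exchange e i - c • e i)) ≤
      -(∑ j, G.a i j * (e i ⬝ᵥ P *ᵥ e i - e j ⬝ᵥ P *ᵥ e j) + 2 * c * (e i ⬝ᵥ P *ᵥ e i)) := by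
  have hP := hAP.1.isHermitian
  have hQ : 0 ≤ e i ⬝ᵥ (-(P * A + Aᵀ * P)) *ᵥ e i := hAP.2.dotProduct_mulVec_nonneg (e i)
  have h2 := lyapunov_quadraticForm_eq (A := A) hP (e i)
  -- Polarization: `2 eᵢᵀ P (eᵢ - eⱼ)` is the difference of the two energies plus the nonnegative
  -- energy of `eᵢ - eⱼ`. The energies thus obey a scalar grounded Laplacian inequality.
  have hj : ∀ j, G.a i j * (e i ⬝ᵥ P *ᵥ e i - e j ⬝ᵥ P *ᵥ e j) ≤
      2 * (G.a i j * (e i ⬝ᵥ P *ᵥ (e i - e j))) := by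
    intro j
    have h3 : 0 ≤ (e i - e j) ⬝ᵥ P *ᵥ (e i - e j) :=
      hAP.1.posSemidef.dotProduct_mulVec_nonneg (e i - e j)
    have h4 := hP.dotProduct_mulVec_comm_real (e j) (e i)
    rw [mulVec_sub, dotProduct_sub, sub_dotProduct, sub_dotProduct] at h3
    rw [mulVec_sub, dotProduct_sub, mul_left_comm]
    refine mul_le_mul_of_nonneg_left ?_ (G.nonneg i j)
    linarith
  have h5 : e i ⬝ᵥ P *ᵥ G.exchange e i = ∑ j, G.a i j * (e i ⬝ᵥ P *ᵥ (e i - e j)) := by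
    rw [WeightedGraph.exchange, mulVec_sum, dotProduct_sum]
    simp only [mulVec_smul, dotProduct_smul, smul_eq_mul]
  have h6 := Finset.sum_le_sum fun j (_ : j ∈ Finset.univ) => hj j
  rw [← Finset.mul_sum, ← h5] at h6
  rw [mulVec_sub, mulVec_sub, dotProduct_sub, dotProduct_sub, mulVec_smul, dotProduct_smul,
    smul_eq_mul]
  linarith

end SatSync

end ErrorSystem

end

section

open Filter Set Topology

/-! ### Convergence of the error system and synchronization -/

section Synchronization

namespace SatSync

variable {n m N : ℕ}

theorem rootIndicator_nonneg (S : Set (Fin N)) (i : Fin N) : 0 ≤ rootIndicator S i :=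
  Set.indicator_nonneg (fun _ _ => zero_le_one) i

theorem rootIndicator_of_mem {S : Set (Fin N)} {i : Fin N} (hi : i ∈ S) : rootIndicator S i = 1 :=
  Set.indicator_of_mem hi _

/-- A family of vectors with bounded positive definite energies is bounded. -/
theorem exists_norm_le_of_energy_le {P : Matrix (Fin n) (Fin n) ℝ} (hP : P.PosDef)
    {z : ℝ → Fin N → Fin n → ℝ} {c : Fin N → ℝ}
    (hz : ∀ i t, 0 ≤ t → z t i ⬝ᵥ P *ᵥ z t i ≤ c i) : ∃ C, ∀ t, 0 ≤ t → ‖z t‖ ≤ C := by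
  obtain ⟨κ, hκ0, hκ⟩ := hP.exists_dotProduct_mulVec_le 1
  simp only [one_mulVec] at hκ
  refine ⟨∑ i, (1 + κ * |c i|), fun t ht => ?_⟩
  have hnn : ∀ i ∈ Finset.univ, 0 ≤ 1 + κ * |c i| := fun i _ => by positivity
  refine (pi_norm_le_iff_of_nonneg (Finset.sum_nonneg hnn)).2 fun i => ?_
  refine le_trans ?_ (Finset.single_le_sum hnn (Finset.mem_univ i))
  refine (pi_norm_le_iff_of_nonneg (by positivity)).2 fun k => ?_
  have h1 : z t i k ^ 2 ≤ z t i ⬝ᵥ z t i := by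
    rw [sq]
    exact Finset.single_le_sum (f := fun k => z t i k * z t i k) (fun k _ => mul_self_nonneg _)
      (Finset.mem_univ k)
  have h2 : κ * (z t i ⬝ᵥ P *ᵥ z t i) ≤ κ * |c i| :=
    mul_le_mul_of_nonneg_left ((hz i t ht).trans (le_abs_self _)) hκ0
  have h3 := hκ (z t i)
  rw [Real.norm_eq_abs]
  nlinarith [sq_abs (z t i k), abs_nonneg (z t i k)]

/-- The error system, in terms of `z i = x i - xr` and `e i = x i - xr - χ i`, converges. -/
theorem errorSystem_tendsto_zero {A P : Matrix (Fin n) (Fin n) ℝ} {B : Matrix (Fin n) (Fin m) ℝ}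
    (hAB : IsControllable A B) (hAP : IsLyapunovMatrix A P) {ρ : ℝ} (hρ : 0 < ρ)
    {G : WeightedGraph N} {S : Set (Fin N)} (hG : G.IsRootedIn S) {z e : ℝ → Fin N → Fin n → ℝ}
    (hz : ∀ i t, 0 ≤ t → HasDerivWithinAt (fun s => z s i)
      (A *ᵥ z t i - B *ᵥ satVec (ρ • (Bᵀ * P) *ᵥ (z t i - e t i))) (Ici 0) t)
    (he : ∀ i t, 0 ≤ t → HasDerivWithinAt (fun s => e s i)
      (A *ᵥ e t i - G.exchange (e t) i - rootIndicator S i • e t i) (Ici 0) t) (i : Fin N) :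
    Tendsto (fun t => z t i) atTop (𝓝 0) := by
  have hP := hAP.1.isHermitian
  set Q := -(P * A + Aᵀ * P) with hQ
  have hPnn : ∀ x : Fin n → ℝ, 0 ≤ x ⬝ᵥ P *ᵥ x := hAP.1.posSemidef.dotProduct_mulVec_nonneg
  have hQnn : ∀ x : Fin n → ℝ, 0 ≤ x ⬝ᵥ Q *ᵥ x := hAP.2.dotProduct_mulVec_nonneg
  -- The grounding is `2ι`, not `ι`, since differentiating the energy doubles the root term.
  obtain ⟨γ, hγ0, hγ⟩ := hG.exists_weight (c := fun i => 2 * rootIndicator S i)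
    (fun i => mul_nonneg zero_le_two (rootIndicator_nonneg S i))
    (fun i hi => by rw [rootIndicator_of_mem hi]; norm_num)
  obtain ⟨κ, hκ0, hκ⟩ := hAP.1.exists_dotProduct_mulVec_le (P * B * (Bᵀ * P))
  -- The part `ρ κ` absorbs the disturbance of `z` by `e`; the extra `1` leaves the energy of `e` in
  -- `D`.
  set c := ρ * κ + 1 with hc
  have hc0 : 0 < c := by positivity
  set z' : ℝ → Fin N → Fin n → ℝ := fun t i =>
    A *ᵥ z t i - B *ᵥ satVec (ρ • (Bᵀ * P) *ᵥ (z t i - e t i)) with hz'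
  set e' : ℝ → Fin N → Fin n → ℝ := fun t i =>
    A *ᵥ e t i - G.exchange (e t) i - rootIndicator S i • e t i with he'
  set W : ℝ → ℝ := fun t =>
    ∑ i, (z t i ⬝ᵥ P *ᵥ z t i + c * γ i * (e t i ⬝ᵥ P *ᵥ e t i)) with hW
  set W' : ℝ → ℝ := fun t =>
    ∑ i, (2 * (z t i ⬝ᵥ P *ᵥ z' t i) + c * γ i * (2 * (e t i ⬝ᵥ P *ᵥ e' t i))) with hW'
  set D : (Fin N → Fin n → ℝ) × (Fin N → Fin n → ℝ) → ℝ := fun w =>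
    ∑ i, (w.1 i ⬝ᵥ Q *ᵥ w.1 i + satWork ρ ((Bᵀ * P) *ᵥ (w.1 i - w.2 i))
      + w.2 i ⬝ᵥ P *ᵥ w.2 i) with hD
  have hWder : ∀ t, 0 ≤ t → HasDerivWithinAt W (W' t) (Ici 0) t := fun t ht =>
    HasDerivWithinAt.fun_sum fun i _ =>
      ((hz i t ht).quadraticForm hP).add (((he i t ht).quadraticForm hP).const_mul _)
  have hWle : ∀ t, W' t ≤ -D (z t, e t) := by
    intro t
    have h1 : ∀ i ∈ Finset.univ, 2 * (z t i ⬝ᵥ P *ᵥ z' t i) ≤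
        -(z t i ⬝ᵥ Q *ᵥ z t i) - satWork ρ ((Bᵀ * P) *ᵥ (z t i - e t i))
          + ρ * κ * (e t i ⬝ᵥ P *ᵥ e t i) := by
      intro i _
      have h2 := agent_energy_le (A := A) B hP hρ (z t i) (e t i)
      have h3 := mul_le_mul_of_nonneg_left (hκ (e t i)) hρ.le
      simp only [hz']
      linarith
    have h2 : ∀ i ∈ Finset.univ, c * γ i * (2 * (e t i ⬝ᵥ P *ᵥ e' t i)) ≤
        -(c * (γ i * (∑ j, G.a i j * (e t i ⬝ᵥ P *ᵥ e t i - e t j ⬝ᵥ P *ᵥ e t j)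
          + 2 * rootIndicator S i * (e t i ⬝ᵥ P *ᵥ e t i)))) := by
      intro i _
      have h3 := mul_le_mul_of_nonneg_left
        (observer_energy_le hAP G (rootIndicator S i) (e t) i) (mul_pos hc0 (hγ0 i)).le
      simp only [he']
      linarith
    have h3 := Finset.sum_le_sum h1
    have h4 := Finset.sum_le_sum h2
    rw [Finset.sum_neg_distrib, ← Finset.mul_sum, hγ fun i => e t i ⬝ᵥ P *ᵥ e t i] at h4
    simp only [Finset.sum_add_distrib, Finset.sum_sub_distrib, Finset.sum_neg_distrib,
      ← Finset.mul_sum] at h3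
    simp only [hW', hD, Finset.sum_add_distrib, ← Finset.mul_sum]
    have h5 : c * ∑ i, e t i ⬝ᵥ P *ᵥ e t i =
        ρ * κ * (∑ i, e t i ⬝ᵥ P *ᵥ e t i) + ∑ i, e t i ⬝ᵥ P *ᵥ e t i := by rw [hc]; ring
    linarith
  have hDnn : ∀ i (w : (Fin N → Fin n → ℝ) × (Fin N → Fin n → ℝ)),
      0 ≤ w.1 i ⬝ᵥ Q *ᵥ w.1 i ∧ 0 ≤ satWork ρ ((Bᵀ * P) *ᵥ (w.1 i - w.2 i)) ∧
      0 ≤ w.2 i ⬝ᵥ P *ᵥ w.2 i := fun i w => ⟨hQnn _, satWork_nonneg hρ _, hPnn _⟩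
  have hterm : ∀ i (w : (Fin N → Fin n → ℝ) × (Fin N → Fin n → ℝ)),
      w.1 i ⬝ᵥ Q *ᵥ w.1 i + satWork ρ ((Bᵀ * P) *ᵥ (w.1 i - w.2 i))
      + w.2 i ⬝ᵥ P *ᵥ w.2 i ≤ D w := fun i w =>
    Finset.single_le_sum (f := fun i => w.1 i ⬝ᵥ Q *ᵥ w.1 i
      + satWork ρ ((Bᵀ * P) *ᵥ (w.1 i - w.2 i)) + w.2 i ⬝ᵥ P *ᵥ w.2 i)
      (fun i _ => add_nonneg (add_nonneg (hDnn i w).1 (hDnn i w).2.1) (hDnn i w).2.2)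
      (Finset.mem_univ i)
  have hD0 : ∀ w, 0 ≤ D w := fun w => Finset.sum_nonneg fun i _ =>
    add_nonneg (add_nonneg (hDnn i w).1 (hDnn i w).2.1) (hDnn i w).2.2
  have hWnn : ∀ t, ∀ i ∈ Finset.univ,
      0 ≤ z t i ⬝ᵥ P *ᵥ z t i + c * γ i * (e t i ⬝ᵥ P *ᵥ e t i) := fun t i _ =>
    add_nonneg (hPnn _) (mul_nonneg (mul_pos hc0 (hγ0 i)).le (hPnn _))
  have hW0 : ∀ t, 0 ≤ t → W t ≤ W 0 := by
    have hanti : AntitoneOn W (Ici 0) := by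
      refine antitoneOn_of_hasDerivWithinAt_nonpos (f' := W') (convex_Ici 0)
        (fun t ht => (hWder t ht).continuousWithinAt) (fun t ht => ?_) (fun t ht => ?_)
      · exact (hWder t (interior_subset ht)).mono interior_subset
      · linarith [hWle t, hD0 (z t, e t)]
    exact fun t ht => hanti (mem_Ici.2 le_rfl) ht ht
  have hWi : ∀ i t, 0 ≤ t →
      z t i ⬝ᵥ P *ᵥ z t i + c * γ i * (e t i ⬝ᵥ P *ᵥ e t i) ≤ W 0 := fun i t ht =>
    (Finset.single_le_sum (hWnn t) (Finset.mem_univ i)).trans (hW0 t ht)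
  -- Bounded energy bounds both `z` and `e`, which provides the uniform continuity in time required
  -- by Barbalat.
  obtain ⟨C₁, hC₁⟩ := exists_norm_le_of_energy_le hAP.1 (z := z) (c := fun _ => W 0)
    fun i t ht => by
      have h1 := mul_nonneg (mul_pos hc0 (hγ0 i)).le (hPnn (e t i))
      linarith [hWi i t ht]
  obtain ⟨C₂, hC₂⟩ := exists_norm_le_of_energy_le hAP.1 (z := e) (c := fun i => W 0 / (c * γ i))
    fun i t ht => by
      rw [le_div_iff₀ (mul_pos hc0 (hγ0 i))]
      linarith [hWi i t ht, hPnn (z t i)]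
  let F : (Fin N → Fin n → ℝ) × (Fin N → Fin n → ℝ) →
      (Fin N → Fin n → ℝ) × (Fin N → Fin n → ℝ) := fun w =>
    (fun i => A *ᵥ w.1 i - B *ᵥ satVec (ρ • (Bᵀ * P) *ᵥ (w.1 i - w.2 i)),
      fun i => A *ᵥ w.2 i - G.exchange w.2 i - rootIndicator S i • w.2 i)
  have hF : Continuous F := by
    have hsat := continuous_satVec (m := m)
    simp only [F, WeightedGraph.exchange]
    fun_prop
  have hstate : ∀ t, 0 ≤ t → HasDerivWithinAt (fun s => (z s, e s)) (F (z t, e t)) (Ici 0) t :=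
    fun t ht => (hasDerivWithinAt_pi.2 fun i => hz i t ht).prodMk
      (hasDerivWithinAt_pi.2 fun i => he i t ht)
  have huc : ∀ h : (Fin N → Fin n → ℝ) × (Fin N → Fin n → ℝ) → ℝ, Continuous h →
      UniformContinuousOn (fun t => h (z t, e t)) (Ici 0) := fun h hh =>
    uniformContinuousOn_comp_of_bounded hF hstate (C := max C₁ C₂)
      (fun t ht => max_le_max (hC₁ t ht) (hC₂ t ht)) hh
  have hDcont : Continuous D := by
    have hsat := continuous_satWork (m := m) ρ
    simp only [hD]
    fun_prop
  have hDlim : Tendsto (fun t => D (z t, e t)) atTop (𝓝 0) :=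
    tendsto_zero_of_hasDerivWithinAt_le_neg hWder (fun t _ => hWle t)
      (fun t _ => Finset.sum_nonneg (hWnn t)) (fun t _ => hD0 _) (huc D hDcont)
  have hQlim : Tendsto (fun t => z t i ⬝ᵥ Q *ᵥ z t i) atTop (𝓝 0) :=
    squeeze_zero (fun t => hQnn _) (fun t => by
      have h1 := hterm i (z t, e t)
      have h2 := hDnn i (z t, e t)
      simp only at h1 h2
      linarith) hDlim
  have hslim : Tendsto (fun t => satWork ρ ((Bᵀ * P) *ᵥ (z t i - e t i))) atTop (𝓝 0) :=
    squeeze_zero (fun t => satWork_nonneg hρ _) (fun t => by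
      have h1 := hterm i (z t, e t)
      have h2 := hDnn i (z t, e t)
      simp only at h1 h2
      linarith) hDlim
  have helim : Tendsto (fun t => e t i ⬝ᵥ P *ᵥ e t i) atTop (𝓝 0) :=
    squeeze_zero (fun t => hPnn _) (fun t => by
      have h1 := hterm i (z t, e t)
      have h2 := hDnn i (z t, e t)
      simp only at h1 h2
      linarith) hDlim
  obtain ⟨hv, hs⟩ := tendsto_zero_of_tendsto_satWork hρ hslim
  have he0 := hAP.1.tendsto_zero_of_quadraticForm helim
  -- The saturated input is now a vanishing perturbation of `z' = A z`.
  refine hAB.tendsto_zero_of_lyapunov hAP.1 (y := fun t => z t i)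
    (r := fun t => -(B *ᵥ satVec (ρ • (Bᵀ * P) *ᵥ (z t i - e t i))))
    (fun t ht => by rw [← sub_eq_add_neg]; exact hz i t ht)
    (by simpa using (hs.matrix_mulVec_zero B).neg)
    (fun h hh => huc (fun w => h (w.1 i)) (by fun_prop)) ?_
    (hAP.2.tendsto_mulVec_zero_of_quadraticForm hQlim)
  have h1 := hv.add (he0.matrix_mulVec_zero (Bᵀ * P))
  rw [add_zero] at h1
  exact h1.congr fun t => by rw [← mulVec_add, sub_add_cancel]

theorem WeightedGraph.exchange_sub (G : WeightedGraph N) {k : ℕ} (v w : Fin N → Fin k → ℝ)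
    (i : Fin N) : G.exchange (fun j => v j - w j) i = G.exchange v i - G.exchange w i := by
  simp only [WeightedGraph.exchange, ← Finset.sum_sub_distrib, ← smul_sub]
  exact Finset.sum_congr rfl fun j _ => by rw [sub_sub_sub_comm]

theorem WeightedGraph.exchange_sub_const (G : WeightedGraph N) {k : ℕ} (v : Fin N → Fin k → ℝ)
    (w : Fin k → ℝ) (i : Fin N) : G.exchange (fun j => v j - w) i = G.exchange v i := by
  simp only [WeightedGraph.exchange, sub_sub_sub_cancel_right]

/-- The full-state coupling protocol solves the scalable synchronization problem. -/
theorem solvesScalableSync_fullStateProtocol {A P : Matrix (Fin n) (Fin n) ℝ}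
    {B : Matrix (Fin n) (Fin m) ℝ} (hAB : IsControllable A B) (hAP : IsLyapunovMatrix A P) {ρ : ℝ}
    (hρ : 0 < ρ) :
    SolvesScalableSync A B (1 : Matrix (Fin n) (Fin n) ℝ) (fullStateProtocol A B P ρ) := by
  intro N S G hG xr0 x0 xc0
  refine ⟨exists_isClosedLoopSolution A B 1 _ G S xr0 x0 xc0, ?_⟩
  intro xr x (χ : ℝ → Fin N → Fin n → ℝ) hsol _ _ _
  have hu : ∀ v : Fin n → ℝ, satVec ((-(ρ • (Bᵀ * P))) *ᵥ v) = -satVec (ρ • (Bᵀ * P) *ᵥ v) := by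
    intro v
    rw [neg_mulVec, satVec_neg, smul_mulVec]
  have hx : ∀ i t, 0 ≤ t → HasDerivWithinAt (fun s => x s i)
      (A *ᵥ x t i + B *ᵥ satVec ((-(ρ • (Bᵀ * P))) *ᵥ χ t i)) (Ici 0) t := hsol.agents
  have hχ : ∀ i t, 0 ≤ t → HasDerivWithinAt (fun s => χ s i)
      (A *ᵥ χ t i + rootIndicator S i • ((-1 : Matrix (Fin n) (Fin n) ℝ) *ᵥ χ t i)
        + B *ᵥ satVec ((-(ρ • (Bᵀ * P))) *ᵥ χ t i)
        + (1 : Matrix (Fin n) (Fin n) ℝ) *ᵥ G.regulatedExchange S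
          (fun j => (1 : Matrix (Fin n) (Fin n) ℝ) *ᵥ x t j)
          ((1 : Matrix (Fin n) (Fin n) ℝ) *ᵥ xr t) i
        + (-1 : Matrix (Fin n) (Fin n) ℝ) *ᵥ G.exchange
          (fun j => (1 : Matrix (Fin n) (Fin n) ℝ) *ᵥ χ t j) i) (Ici 0) t := hsol.protocols
  have hneg : ∀ v : Fin n → ℝ, (-1 : Matrix (Fin n) (Fin n) ℝ) *ᵥ v = -v := fun v => by
    rw [neg_mulVec, one_mulVec]
  simp only [one_mulVec, hneg] at hχ
  have hlim : ∀ i, Tendsto (fun t => x t i - xr t) atTop (𝓝 0) := by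
    refine errorSystem_tendsto_zero hAB hAP hρ hG (z := fun t i => x t i - xr t)
      (e := fun t i => x t i - xr t - χ t i) (fun i t ht => ?_) (fun i t ht => ?_)
    · convert! (hx i t ht).sub (hsol.exosystem t ht) using 1
      rw [hu, sub_sub_cancel, mulVec_sub, mulVec_neg]
      abel
    -- The terms `B σ(u)` cancel and `xr` drops out of the exchange, which leaves the autonomous
    -- equation for `e`.
    · convert! ((hx i t ht).sub (hsol.exosystem t ht)).sub (hχ i t ht) using 1
      rw [G.exchange_sub, G.exchange_sub_const, WeightedGraph.regulatedExchange, mulVec_sub,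
        mulVec_sub, smul_sub, smul_neg]
      abel
  refine ⟨hlim, fun i j => ?_⟩
  have h := (hlim i).sub (hlim j)
  rw [sub_zero] at h
  exact h.congr fun t => sub_sub_sub_cancel_right _ _ _

end SatSync

end Synchronization

end

theorem mainTheorem6 {n m : ℕ} (A : Matrix (Fin n) (Fin n) ℝ) (B : Matrix (Fin n) (Fin m) ℝ)
    (hAB : SatSync.NeutrallyStableAgent A B (1 : Matrix (Fin n) (Fin n) ℝ)) :
    SatSync.ScalableSyncSolvable A B (1 : Matrix (Fin n) (Fin n) ℝ) ∧
    (∃ P, SatSync.IsLyapunovMatrix A P) ∧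
    (∀ P, SatSync.IsLyapunovMatrix A P → ∀ ρ : ℝ, 0 < ρ →
      SatSync.SolvesScalableSync A B (1 : Matrix (Fin n) (Fin n) ℝ)
        (SatSync.fullStateProtocol A B P ρ)) := by
  have hP := hAB.neutrallyStable.exists_isLyapunovMatrix
  have hsolve : ∀ P, SatSync.IsLyapunovMatrix A P → ∀ ρ : ℝ, 0 < ρ →
      SatSync.SolvesScalableSync A B (1 : Matrix (Fin n) (Fin n) ℝ)
        (SatSync.fullStateProtocol A B P ρ) := fun P hAP ρ hρ =>
    SatSync.solvesScalableSync_fullStateProtocol hAB.controllable hAP hρ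
  obtain ⟨P, hAP⟩ := hP
  exact ⟨⟨_, hsolve P hAP 1 one_pos⟩, ⟨P, hAP⟩, hsolve⟩
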